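/- Let $(\Omega,\mathcal A,\mathbb P)$ be a (complete) probability space and let $(S,\mathcal S,\mu)$ be a $\sigma$-finite measure space with the approximation-by-averaging property: for every $n\in\mathbb N$ there is an at most countable family $\mathfrak B_n$ of pairwise disjoint measurable subsets of $S$ of positive finite measure such that, for every real Banach space $E$, all $p\in[1,\infty)$ and every $f\in L^p(S;E)$, the functions $f_n=\sum_{B\in\mathfrak B_n}\mathbf 1_B\,\mu(B)^{-1}\int_B f\,\mathrm d\mu$ converge to $f$ in $L^p(S;E)$. Let $q\in(1,2)$, $p\in[1,q]$, $\widetilde q\in[q,\infty)$, $\widehat q:=\min\{\widetilde q,2\}$, and $X\in L^1(\Omega;L^p(S))$. For every $\ell\in\mathbb N=\{1,2,\dots\}$ let $X_\ell\in L^{\widetilde q}(\Omega;L^p(S))\cap L^p(S;L^{\widetilde q}(\Omega))$, set $X_0:=0$ and $\xi_\ell:=X_\ell-X_{\ell-1}$, and let $\mathcal C_\ell$ denote the cost of generating one sample of $\xi_\ell$. (An $L^p(S)$-valued random variable $\eta$ belongs to $L^p(S;L^{r}(\Omega))$ if it has a jointly measurable version $\widetilde\eta\colon S\times\Omega\to\mathbb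 R$, with $\eta(\omega)=\widetilde\eta(\cdot,\omega)$ in $L^p(S)$ for a.e. $\omega$, such that $s\mapsto\widetilde\eta(s,\cdot)$ is in $L^p(S;L^{r}(\Omega))$; its norm is the norm of this map.) Suppose that there are a function $\beta\colon[q,\widehat q]\to(0,\infty)$, constants $\alpha,\gamma,C_\alpha,C_\beta,C_\gamma,c_1,c_2\in(0,\infty)$, $A\in(1,\infty)$ and real numbers $(N_\ell)_{\ell\in\mathbb N}$ with $c_1A^\ell\le N_\ell\le c_2A^\ell$ such that, for all $\ell\in\mathbb N$, $$\|\mathbb E[X]-\mathbb E[X_\ell]\|_{L^p(S)}\le C_\alpha N_\ell^{-\alpha},\qquad \mathcal C_\ell\le C_\gamma N_\ell^{\gamma},$$ $$\|X_\ell-\mathbb E[X_\ell]-(X_{\ell-1}-\mathbb E[X_{\ell-1}])\|_{L^p(S;L^r(\Omega))}\le C_\beta N_\ell^{-\beta(r)}\quad\text{for all } r\in[q,\widehat q].$$ For each $\ell\in\mathbb N$ let $(\xi_{\ell,j})_{j\in\mathbb N}\subset L^{\widetilde q}(\Omega;L^p(S))\cap L^p(S;L^{\widetilde q}(\Omega))$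 be a sequence of independent copies of $\xi_\ell$. Then, for every $r\in[q,\widehat q]$, with $r':=\frac{r}{r-1}$, there is a constant $K\in(0,\infty)$, depending only on $p,q,\widetilde q,r,\alpha,\beta,\gamma,C_\alpha,C_\beta,C_\gamma,A,c_1,c_2$, such that for every $\epsilon\in(0,\frac12]$ there exist $L\in\mathbb N$ and $M_1,\dots,M_L\in\mathbb N$ with $$\Bigl\|\mathbb E[X]-\sum_{\ell=1}^L\frac1{M_\ell}\sum_{j=1}^{M_\ell}\xi_{\ell,j}\Bigr\|_{L^q(\Omega;L^p(S))}<\epsilon$$ and computational cost $$\sum_{\ell=1}^L\mathcal C_\ell M_\ell\le K\cdot\begin{cases}\epsilon^{-\gamma/\alpha}+\epsilon^{-r'}&\text{if }\beta(r)>\gamma/r',\\ \epsilon^{-\gamma/\alpha}+\epsilon^{-r'}|\log_A\epsilon|^{r'+1}&\text{if }\beta(r)=\gamma/r',\\ \epsilon^{-\gamma/\alpha}+\epsilon^{-r'-(\gamma-\beta(r)r')/\alpha}&\text{if }\beta(r)<\gamma/r'.\end{cases}$$ -/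

import Mathlib

open MeasureTheory ProbabilityTheory Filter Topology
open scoped ENNReal

universe u v

noncomputable section

namespace MLMC

/-- The function `∑_{B ∈ 𝔅} 1_B (μ(B)⁻¹ ∫_B f dμ)`. For a pairwise disjoint family `𝔅`, at most
one term of the sum is nonzero at each point. -/
def averaging {S : Type u} [MeasurableSpace S] (μ : Measure S) (𝔅 : Set (Set S))
    {E : Type v} [NormedAddCommGroup E] [NormedSpace ℝ E] (f : S → E) : S → E :=
  fun s => ∑' B : 𝔅, (B : Set S).indicator (fun _ => ⨍ t in (B : Set S), f t ∂μ) s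

/-- The approximation-by-averaging property of a measure space: there are countable families
`𝔅 n` of pairwise disjoint measurable sets of positive finite measure such that, for every Banach
space `E`, every `p ∈ [1, ∞)` and every `f ∈ L^p(S; E)`, the averages of `f` over `𝔅 n` converge
to `f` in `L^p(S; E)`. -/
def ApproxByAveraging {S : Type u} [MeasurableSpace S] (μ : Measure S) : Prop :=
  ∃ 𝔅 : ℕ → Set (Set S),
    (∀ n, (𝔅 n).Countable ∧ (𝔅 n).PairwiseDisjoint id ∧
      ∀ B ∈ 𝔅 n, MeasurableSet B ∧ 0 < μ B ∧ μ B < ∞) ∧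
    ∀ (E : Type v) [NormedAddCommGroup E] [NormedSpace ℝ E] [CompleteSpace E]
      (p : ℝ≥0∞), 1 ≤ p → p ≠ ∞ → ∀ f : S → E, MemLp f p μ →
        Tendsto (fun n => eLpNorm (f - averaging μ (𝔅 n) f) p μ) atTop (𝓝 0)

section Swapped

variable {S : Type u} [MeasurableSpace S] {μ : Measure S}
  {Ω : Type v} [MeasurableSpace Ω] {p : ℝ≥0∞}

/-- `Y` is a measurable function on the product space with `η(ω) = Y(·, ω)` in `L^p(S)` for
almost every `ω`. -/
def IsJointVersion (P : Measure Ω) (η : Ω → Lp ℝ p μ) (Y : S × Ω → ℝ) : Prop :=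
  Measurable Y ∧ ∀ᵐ ω ∂P, η ω =ᵐ[μ] fun s => Y (s, ω)

/-- The `L^p(S)`-valued random variable `η` corresponds to the element `g` of the Bochner space
`L^p(S; L^q(Ω))`: there is a jointly measurable version `Y` of `η` with `g(s) = Y(s, ·)` in
`L^q(Ω)` for almost every `s`. Such a `g` is unique almost everywhere. -/
def IsSwap (P : Measure Ω) (q : ℝ≥0∞) [Fact (1 ≤ q)] (η : Ω → Lp ℝ p μ)
    (g : S → Lp ℝ q P) : Prop :=
  MemLp g p μ ∧ ∃ Y : S × Ω → ℝ, IsJointVersion P η Y ∧ ∀ᵐ s ∂μ, g s =ᵐ[P] fun ω => Y (s, ω)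

/-- `η ∈ L^p(S; L^q(Ω))`, with `q ∈ [1, ∞]`. -/
def MemSwap (P : Measure Ω) (q : ℝ≥0∞) (η : Ω → Lp ℝ p μ) : Prop :=
  ∃ _ : Fact (1 ≤ q), ∃ g : S → Lp ℝ q P, IsSwap P q η g

/-- The norm of `η` in `L^p(S; L^q(Ω))`, with value `∞` if `η` is not in this space. -/
def swapNorm (P : Measure Ω) (q : ℝ≥0∞) (η : Ω → Lp ℝ p μ) : ℝ≥0∞ :=
  ⨅ (_ : Fact (1 ≤ q)) (g : S → Lp ℝ q P) (_ : IsSwap P q η g), eLpNorm g p μ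

end Swapped

/-- The multilevel Monte Carlo estimator `∑_{ℓ=1}^L (1/M_ℓ) ∑_j ξ_{ℓ,j}`, using `M_ℓ` samples on
level `ℓ` (samples are numbered from `0`). -/
def estimator {Ω : Type v} {V : Type u} [AddCommGroup V] [Module ℝ V]
    (ξ : ℕ → ℕ → Ω → V) (L : ℕ) (M : ℕ → ℕ) (ω : Ω) : V :=
  ∑ l ∈ Finset.Icc 1 L, (1 / (M l : ℝ)) • ∑ j ∈ Finset.range (M l), ξ l j ω

/-- The cost of the estimator, where `cost ℓ` is the cost of one sample on level `ℓ`. -/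
def totalCost (cost : ℕ → ℝ) (L : ℕ) (M : ℕ → ℕ) : ℝ :=
  ∑ l ∈ Finset.Icc 1 L, cost l * (M l : ℝ)

/-- The order of the cost in terms of the accuracy `ε`, where `b` is the strong rate and `r'` the
exponent conjugate to the integrability parameter. -/
def costOrder (α b γ A r' ε : ℝ) : ℝ :=
  if γ / r' < b then
    ε ^ (-(γ / α)) + ε ^ (-r')
  else if b = γ / r' then
    ε ^ (-(γ / α)) + ε ^ (-r') * |Real.logb A ε| ^ (r' + 1)
  else
    ε ^ (-(γ / α)) + ε ^ (-r' - (γ - b * r') / α)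

end MLMC

end

namespace MLMC

/-! The error is at most the bias on level `L` plus the statistical errors of the levels
(`eLpNorm_sub_estimator_le`). Each statistical error decays like `m ^ (-1/r')` in the number `m` of
samples (`eLpNorm_sampleMean_sub_le`), although `L^p(S)` itself need not have type `r` when `p < r`.
Since `p ≤ r`, Minkowski's integral inequality bounds the `L^r(Ω; L^p(S))` norm by the `L^p(S;
L^r(Ω))` norm, where only scalar random variables matter and the von Bahr–Esseen inequality applies.

Evaluation at a point of `S` is not defined on `L^p(S)`, so independence cannot be transferred to
the values of a joint version. Averages over sets `B` of finite measure are continuous functionals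
of the samples and do inherit independence and laws. The scalar inequality therefore holds on every
`B ∈ 𝔅 n`, and approximation by averaging lets `n → ∞` (`eLpNorm_sum_swap_le`).

It remains to optimise (`exists_levels_samples`): `L` makes the bias at most `ε / 4`, and positive
weights distribute another `ε / 4` over the levels. The three cost regimes correspond to weights
that grow with the level, are constant, or decay with the level. -/

/-! ### The scalar von Bahr–Esseen inequality. -/

lemma abs_rpow_sub_two_mul_self {t : ℝ} (ht : 1 < t) (x : ℝ) :
    |(|x| ^ (t - 2) * x)| = |x| ^ (t - 1) := by
  rcases eq_or_ne x 0 with rfl | hx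
  · simp [Real.zero_rpow (by linarith : t - 1 ≠ 0)]
  · rw [abs_mul, abs_of_nonneg (by positivity), ← Real.rpow_add_one (abs_ne_zero.2 hx)]
    congr 1; ring

lemma rpow_sub_two_mul_self {t : ℝ} (ht : 1 < t) {x : ℝ} (hx : 0 ≤ x) :
    |x| ^ (t - 2) * x = x ^ (t - 1) := by
  have h := abs_rpow_sub_two_mul_self ht x
  rw [abs_of_nonneg hx] at h ⊢
  rwa [abs_of_nonneg (by positivity)] at h

/-- The signed power `x ↦ |x| ^ (t - 2) * x` is Hölder continuous of order `t - 1`. -/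
lemma abs_signedPow_sub_le {t : ℝ} (ht : 1 < t) (ht2 : t ≤ 2) (x y : ℝ) :
    |(|x| ^ (t - 2) * x - |y| ^ (t - 2) * y)| ≤ 2 * |x - y| ^ (t - 1) := by
  -- Subadditivity of `x ↦ x ^ (t - 1)`, whose exponent lies in `(0, 1]`.
  have ordered : ∀ a b : ℝ, 0 ≤ a → a ≤ b → b ^ (t - 1) - a ^ (t - 1) ≤ (b - a) ^ (t - 1) := by
    intro a b ha hab
    have h := Real.rpow_add_le_add_rpow ha (sub_nonneg.2 hab) (by linarith : 0 ≤ t - 1)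
      (by linarith)
    rw [add_sub_cancel] at h
    linarith
  have nonneg : ∀ a b : ℝ, 0 ≤ a → 0 ≤ b →
      |a ^ (t - 1) - b ^ (t - 1)| ≤ 2 * |a - b| ^ (t - 1) := by
    intro a b ha hb
    have h0 : 0 ≤ |a - b| ^ (t - 1) := by positivity
    rcases le_total a b with h | h
    · rw [abs_sub_comm, abs_of_nonneg (sub_nonneg.2 (Real.rpow_le_rpow ha h (by linarith)))]
      have := ordered a b ha h
      rw [abs_sub_comm, abs_of_nonneg (sub_nonneg.2 h)] at h0 ⊢
      linarith
    · rw [abs_of_nonneg (sub_nonneg.2 (Real.rpow_le_rpow hb h (by linarith)))]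
      have := ordered b a hb h
      rw [abs_of_nonneg (sub_nonneg.2 h)] at h0 ⊢
      linarith
  have opposite : ∀ a b : ℝ, 0 ≤ a → 0 ≤ b →
      a ^ (t - 1) + b ^ (t - 1) ≤ 2 * (a + b) ^ (t - 1) := by
    intro a b ha hb
    have h1 := Real.rpow_le_rpow ha (le_add_of_nonneg_right hb) (by linarith : 0 ≤ t - 1)
    have h2 := Real.rpow_le_rpow hb (le_add_of_nonneg_left ha) (by linarith : 0 ≤ t - 1)
    linarith
  have neg : ∀ a : ℝ, a ≤ 0 → |a| ^ (t - 2) * a = -(-a) ^ (t - 1) := by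
    intro a ha
    have h := rpow_sub_two_mul_self ht (neg_nonneg.2 ha)
    rw [abs_neg] at h
    linarith
  rcases le_total 0 x with hx | hx <;> rcases le_total 0 y with hy | hy
  · rw [rpow_sub_two_mul_self ht hx, rpow_sub_two_mul_self ht hy]
    exact nonneg x y hx hy
  · rw [rpow_sub_two_mul_self ht hx, neg y hy, sub_neg_eq_add, abs_of_nonneg
      (add_nonneg (by positivity) (Real.rpow_nonneg (neg_nonneg.2 hy) _)),
      abs_of_nonneg (by linarith : 0 ≤ x - y)]
    exact opposite x (-y) hx (neg_nonneg.2 hy)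
  · rw [neg x hx, rpow_sub_two_mul_self ht hy, ← abs_neg, neg_sub, sub_neg_eq_add, abs_of_nonneg
      (add_nonneg (by positivity) (Real.rpow_nonneg (neg_nonneg.2 hx) _)),
      abs_sub_comm, abs_of_nonneg (by linarith : 0 ≤ y - x)]
    exact opposite y (-x) hy (neg_nonneg.2 hx)
  · rw [neg x hx, neg y hy, neg_sub_neg, abs_sub_comm x y, abs_sub_comm]
    have := nonneg (-y) (-x) (neg_nonneg.2 hy) (neg_nonneg.2 hx)
    rwa [show -y - -x = x - y by ring, abs_sub_comm x y, abs_sub_comm] at this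

/-- First order expansion of `|x| ^ t` with a remainder of order `t`. -/
lemma abs_add_rpow_le {t : ℝ} (ht : 1 < t) (ht2 : t ≤ 2) (a b : ℝ) :
    |a + b| ^ t ≤ |a| ^ t + t * ((|a| ^ (t - 2) * a) * b) + 4 * |b| ^ t := by
  have hd : ∀ u : ℝ, HasDerivAt (fun u : ℝ => |a + u * b| ^ t)
      (t * |a + u * b| ^ (t - 2) * (a + u * b) * b) u := by
    intro u
    have h1 : HasDerivAt (fun u : ℝ => a + u * b) b u := by
      simpa using ((hasDerivAt_id u).mul_const b).const_add a
    exact (hasDerivAt_abs_rpow (a + u * b) ht).comp u h1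
  -- The mean value theorem gives the derivative at an intermediate point `a + u * b`. Moving it to
  -- `a` changes the signed power by at most `2 * |u * b| ^ (t - 1)`; with the factor `t ≤ 2` this
  -- yields the constant 4.
  obtain ⟨u, hu, he⟩ := exists_hasDerivAt_eq_slope (fun u : ℝ => |a + u * b| ^ t)
    (fun u => t * |a + u * b| ^ (t - 2) * (a + u * b) * b) (zero_lt_one' ℝ)
    (fun x _ => (hd x).continuousAt.continuousWithinAt) (fun x _ => hd x)
  simp only [one_mul, zero_mul, add_zero, sub_zero, div_one] at he
  have h2 := abs_signedPow_sub_le ht ht2 (a + u * b) a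
  rw [add_sub_cancel_left, abs_mul] at h2
  have h3 : (|u| * |b|) ^ (t - 1) ≤ |b| ^ (t - 1) := by
    refine Real.rpow_le_rpow (by positivity) ?_ (by linarith)
    have : |u| ≤ 1 := abs_le.2 ⟨by linarith [hu.1], hu.2.le⟩
    exact mul_le_of_le_one_left (abs_nonneg b) this
  have h4 : |b| ^ (t - 1) * |b| = |b| ^ t := by
    rcases eq_or_ne b 0 with rfl | hb
    · simp [Real.zero_rpow (by linarith : t ≠ 0)]
    · rw [← Real.rpow_add_one (abs_ne_zero.2 hb)]; congr 1; ring
  set D := |a + u * b| ^ (t - 2) * (a + u * b) - |a| ^ (t - 2) * a with hD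
  have h5 : D * b ≤ 2 * |b| ^ t := calc
    D * b ≤ |D| * |b| := by rw [← abs_mul]; exact le_abs_self _
    _ ≤ (2 * |b| ^ (t - 1)) * |b| := by gcongr; linarith
    _ = 2 * |b| ^ t := by rw [mul_assoc, h4]
  have h6 : t * (D * b) ≤ 4 * |b| ^ t := by
    have h0 : 0 ≤ |b| ^ t := by positivity
    nlinarith
  rw [hD] at h6
  nlinarith

/-- **von Bahr–Esseen inequality**: independent centred random variables in `L^t`, `1 < t ≤ 2`. -/
theorem integral_abs_sum_rpow_le {Ω ι : Type*} [MeasurableSpace Ω] {P : Measure Ω}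
    [IsProbabilityMeasure P] {t : ℝ} (ht : 1 < t) (ht2 : t ≤ 2) {U : ι → Ω → ℝ}
    (hU : ∀ j, MemLp (U j) (ENNReal.ofReal t) P) (hind : iIndepFun U P)
    (hmean : ∀ j, ∫ ω, U j ω ∂P = 0) (s : Finset ι) :
    ∫ ω, |∑ j ∈ s, U j ω| ^ t ∂P ≤ 4 * ∑ j ∈ s, ∫ ω, |U j ω| ^ t ∂P := by
  classical
  have ht0 : ENNReal.ofReal t ≠ 0 := by simp; linarith
  have hint : ∀ {V : Ω → ℝ}, MemLp V (ENNReal.ofReal t) P →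
      Integrable (fun ω => |V ω| ^ t) P := by
    intro V hV
    have := hV.integrable_norm_rpow ht0 ENNReal.ofReal_ne_top
    simpa [ENNReal.toReal_ofReal (by linarith : 0 ≤ t)] using this
  have h1t : (1 : ℝ≥0∞) ≤ ENNReal.ofReal t := by
    rw [← ENNReal.ofReal_one]; exact ENNReal.ofReal_le_ofReal ht.le
  induction s using Finset.induction_on with
  | empty => simp [Real.zero_rpow (by linarith : t ≠ 0)]
  | insert i s hi ih =>
    have hS : MemLp (fun ω => ∑ j ∈ s, U j ω) (ENNReal.ofReal t) P :=
      memLp_finsetSum s fun j _ => hU j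
    have hφm : Measurable fun x : ℝ => |x| ^ (t - 2) * x := by fun_prop
    have hφi : Integrable (fun ω => |∑ j ∈ s, U j ω| ^ (t - 2) * ∑ j ∈ s, U j ω) P := by
      -- Domination by `y ^ (t - 1) ≤ y ^ t + 1`.
      refine Integrable.mono' ((hint hS).add (integrable_const (1 : ℝ)))
        (hφm.comp_aemeasurable hS.1.aemeasurable).aestronglyMeasurable (ae_of_all _ fun ω => ?_)
      rw [Real.norm_eq_abs, abs_rpow_sub_two_mul_self ht]
      simp only [Pi.add_apply]
      set y := |∑ j ∈ s, U j ω|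
      have hy : 0 ≤ y := abs_nonneg _
      rcases le_total y 1 with h | h
      · have := Real.rpow_le_one hy h (by linarith : 0 ≤ t - 1)
        have : 0 ≤ y ^ t := by positivity
        linarith
      · have := Real.rpow_le_rpow_of_exponent_le h (by linarith : t - 1 ≤ t)
        linarith
    have hindep : IndepFun (fun ω => |∑ j ∈ s, U j ω| ^ (t - 2) * ∑ j ∈ s, U j ω) (U i) P := by
      have h := hind.indepFun_finsetSum_of_notMem₀ (fun j => (hU j).1.aemeasurable) hi
      have h' := h.comp hφm measurable_id
      simpa [Function.comp_def] using h'
    have hprod : Integrable (fun ω => (|∑ j ∈ s, U j ω| ^ (t - 2) * ∑ j ∈ s, U j ω) * U i ω) P :=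
      hindep.integrable_mul hφi ((hU i).integrable h1t)
    -- The first-order term vanishes: the partial sum is independent of the new centred summand.
    -- Only the remainder of order `t` survives.
    have hzero : ∫ ω, (|∑ j ∈ s, U j ω| ^ (t - 2) * ∑ j ∈ s, U j ω) * U i ω ∂P = 0 := by
      rw [hindep.integral_fun_mul_eq_mul_integral hφi.1 (hU i).1, hmean i, mul_zero]
    have hA := hint hS
    have hB := hprod.const_mul t
    have hC := (hint (hU i)).const_mul 4
    have hle : ∫ ω, |∑ j ∈ insert i s, U j ω| ^ t ∂P ≤
        ∫ ω, (|∑ j ∈ s, U j ω| ^ t +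
          t * ((|∑ j ∈ s, U j ω| ^ (t - 2) * ∑ j ∈ s, U j ω) * U i ω) + 4 * |U i ω| ^ t) ∂P := by
      refine integral_mono (hint (memLp_finsetSum _ fun j _ => hU j)) ((hA.add hB).add hC)
        fun ω => ?_
      simp only
      rw [Finset.sum_insert hi, add_comm]
      exact abs_add_rpow_le ht ht2 _ _
    have hAB := hA.add hB
    simp only [Pi.add_def] at hAB
    rw [integral_add hAB hC, integral_add hA hB, integral_const_mul, hzero,
      integral_const_mul] at hle
    rw [Finset.sum_insert hi]
    linarith

/-- Equal moments turn the sum into a factor `4 * m`; its root `1 / t < 1` is the gain over the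
triangle inequality. -/
theorem eLpNorm_sum_le_of_identDistrib {Ω Ω' : Type*} [MeasurableSpace Ω] [MeasurableSpace Ω']
    {P : Measure Ω} {P' : Measure Ω'}
    [IsProbabilityMeasure P] {t : ℝ} (ht : 1 < t) (ht2 : t ≤ 2) {U : ℕ → Ω → ℝ} {V : Ω' → ℝ}
    (hV : MemLp V (ENNReal.ofReal t) P') (hind : iIndepFun U P)
    (hUV : ∀ j, IdentDistrib (U j) V P P') (hmean : ∫ ω, V ω ∂P' = 0) (m : ℕ) :
    eLpNorm (fun ω => ∑ j ∈ Finset.range m, U j ω) (ENNReal.ofReal t) P ≤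
      ENNReal.ofReal ((4 * m) ^ t⁻¹) * eLpNorm V (ENNReal.ofReal t) P' := by
  have ht0 : ENNReal.ofReal t ≠ 0 := by simp; linarith
  have hU : ∀ j, MemLp (U j) (ENNReal.ofReal t) P := fun j => (hUV j).memLp_iff.2 hV
  have hsum : MemLp (fun ω => ∑ j ∈ Finset.range m, U j ω) (ENNReal.ofReal t) P :=
    memLp_finsetSum _ fun j _ => hU j
  rw [hsum.eLpNorm_eq_integral_rpow_norm ht0 ENNReal.ofReal_ne_top,
    hV.eLpNorm_eq_integral_rpow_norm ht0 ENNReal.ofReal_ne_top,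
    ENNReal.toReal_ofReal (by linarith), ← ENNReal.ofReal_mul (by positivity),
    ← Real.mul_rpow (by positivity) (integral_nonneg fun _ => by positivity)]
  refine ENNReal.ofReal_le_ofReal (Real.rpow_le_rpow (integral_nonneg fun _ => by positivity) ?_
    (by positivity))
  have h := integral_abs_sum_rpow_le ht ht2 hU hind
    (fun j => (hUV j).integral_eq.trans hmean) (Finset.range m)
  have heq : ∀ j, ∫ ω, |U j ω| ^ t ∂P = ∫ ω, |V ω| ^ t ∂P' := fun j =>
    ((hUV j).comp (u := fun x : ℝ => |x| ^ t) (by fun_prop)).integral_eq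
  simp only [heq, Finset.sum_const, Finset.card_range, nsmul_eq_mul] at h
  simp only [Real.norm_eq_abs]
  linarith

/-! ### Continuous linear maps on `L^p`. -/

section LpMaps

variable {α : Type*} [MeasurableSpace α] {μ : Measure α}

lemma lintegral_enorm_restrict_le {p : ℝ≥0∞} [hp : Fact (1 ≤ p)] (B : Set α) (f : Lp ℝ p μ) :
    ∫⁻ a in B, ‖f a‖ₑ ∂μ ≤ μ B ^ (1 - 1 / p.toReal) * ‖f‖ₑ := by
  have hm : AEStronglyMeasurable f μ := (Lp.memLp f).1
  rw [← eLpNorm_one_eq_lintegral_enorm, Lp.enorm_def, mul_comm]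
  refine (eLpNorm_le_eLpNorm_mul_rpow_measure_univ hp.out hm.restrict).trans ?_
  simp only [ENNReal.toReal_one, div_one, Measure.restrict_apply_univ]
  gcongr
  exact Measure.restrict_le_self

lemma rpow_one_sub_toReal_ne_top {p : ℝ≥0∞} [hp : Fact (1 ≤ p)] {B : Set α} (hB : μ B ≠ ∞) :
    μ B ^ (1 - 1 / p.toReal) ≠ ∞ := by
  refine ENNReal.rpow_ne_top_of_nonneg ?_ hB
  -- `ENNReal.toReal ∞ = 0`, so the exponent is 1 for `p = ∞`, as Hölder's inequality requires.
  rcases eq_or_ne p ∞ with rfl | h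
  · simp
  · have : 1 ≤ p.toReal := by simpa using ENNReal.toReal_mono h hp.out
    rw [sub_nonneg]
    exact div_le_one_of_le₀ this (by linarith)

lemma integrableOn_coeFn {p : ℝ≥0∞} [hp : Fact (1 ≤ p)] {B : Set α} (hB : μ B ≠ ∞)
    (f : Lp ℝ p μ) : IntegrableOn f B μ :=
  ⟨(Lp.memLp f).1.restrict, (lintegral_enorm_restrict_le B f).trans_lt
    (ENNReal.mul_lt_top (rpow_one_sub_toReal_ne_top hB).lt_top (by simp))⟩

/-- Integration over a set of finite measure, as a continuous linear functional on `L^p`. -/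
noncomputable def setIntegralCLM (p : ℝ≥0∞) [Fact (1 ≤ p)] (B : Set α) (hB : μ B ≠ ∞) :
    Lp ℝ p μ →L[ℝ] ℝ :=
  LinearMap.mkContinuous
    { toFun := fun f => ∫ a in B, f a ∂μ
      map_add' := fun f g => by
        rw [← integral_add (integrableOn_coeFn hB f) (integrableOn_coeFn hB g)]
        exact integral_congr_ae (ae_restrict_of_ae (Lp.coeFn_add f g))
      map_smul' := fun c f => by
        rw [RingHom.id_apply, smul_eq_mul, ← integral_const_mul]
        exact integral_congr_ae (ae_restrict_of_ae (Lp.coeFn_smul c f)) }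
    (μ B ^ (1 - 1 / p.toReal)).toReal fun f => by
      have h := (enorm_integral_le_lintegral_enorm _).trans (lintegral_enorm_restrict_le B f)
      have h' := ENNReal.toReal_mono
        (ENNReal.mul_ne_top (rpow_one_sub_toReal_ne_top hB) enorm_ne_top) h
      simpa [ENNReal.toReal_mul] using h'

lemma setIntegralCLM_apply {p : ℝ≥0∞} [Fact (1 ≤ p)] {B : Set α} (hB : μ B ≠ ∞)
    (f : Lp ℝ p μ) : setIntegralCLM p B hB f = ∫ a in B, f a ∂μ := rfl

/-- The inclusion `L^p ⊆ L^q` for `q ≤ p` over a probability measure. -/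
noncomputable def inclusionCLM {p q : ℝ≥0∞} [Fact (1 ≤ p)] [Fact (1 ≤ q)]
    [IsProbabilityMeasure μ] (h : q ≤ p) : Lp ℝ p μ →L[ℝ] Lp ℝ q μ :=
  LinearMap.mkContinuous
    { toFun := fun f => ((Lp.memLp f).mono_exponent h).toLp f
      map_add' := fun f g => by
        rw [← MemLp.toLp_add]
        exact MemLp.toLp_congr _ _ (Lp.coeFn_add f g)
      map_smul' := fun c f => by
        rw [RingHom.id_apply, ← MemLp.toLp_const_smul]
        exact MemLp.toLp_congr _ _ (Lp.coeFn_smul c f) }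
    1 fun f => by
      rw [one_mul]
      refine (Lp.norm_toLp _ ((Lp.memLp f).mono_exponent h)).trans_le ?_
      rw [Lp.norm_def]
      exact ENNReal.toReal_mono (Lp.eLpNorm_ne_top f)
        (eLpNorm_le_eLpNorm_of_exponent_le h (Lp.memLp f).1)

lemma coeFn_inclusionCLM {p q : ℝ≥0∞} [Fact (1 ≤ p)] [Fact (1 ≤ q)]
    [IsProbabilityMeasure μ] (h : q ≤ p) (f : Lp ℝ p μ) :
    (inclusionCLM h f : Lp ℝ q μ) =ᵐ[μ] f :=
  MemLp.coeFn_toLp ((Lp.memLp f).mono_exponent h)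

/-- Subtraction of the mean, as a continuous linear map on `L^p` of a probability measure. -/
noncomputable def centerCLM (p : ℝ≥0∞) [Fact (1 ≤ p)] (P : Measure α) [IsProbabilityMeasure P] :
    Lp ℝ p P →L[ℝ] Lp ℝ p P :=
  ContinuousLinearMap.id ℝ _ -
    (setIntegralCLM p Set.univ (measure_ne_top P _)).smulRight (Lp.const p P (1 : ℝ))

lemma coeFn_centerCLM {p : ℝ≥0∞} [Fact (1 ≤ p)] {P : Measure α} [IsProbabilityMeasure P]
    (f : Lp ℝ p P) : centerCLM p P f =ᵐ[P] fun a => f a - ∫ b, f b ∂P := by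
  have h : centerCLM p P f = f - (∫ b, f b ∂P) • Lp.const p P (1 : ℝ) := by
    simp [centerCLM, setIntegralCLM_apply]
  rw [h]
  filter_upwards [Lp.coeFn_sub f ((∫ b, f b ∂P) • Lp.const p P (1 : ℝ)),
    Lp.coeFn_smul (∫ b, f b ∂P) (Lp.const p P (1 : ℝ)), Lp.coeFn_const (p := p) (μ := P) (1 : ℝ)]
    with a h1 h2 h3
  rw [h1, Pi.sub_apply, h2, Pi.smul_apply, h3]
  simp

end LpMaps

/-! ### Bochner integrals in `L^p` and joint versions. -/

section Fubini

variable {α β : Type*} [MeasurableSpace α] [MeasurableSpace β] {μ : Measure α} {ν : Measure β}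
  [SFinite ν] {p : ℝ≥0∞} [Fact (1 ≤ p)] {η : β → Lp ℝ p μ} {Y : α → β → ℝ}

/-- On a set of finite measure, Hölder bounds the `L^1` norm of each section by a multiple of `‖η
b‖`, which is integrable. -/
lemma integrable_uncurry_restrict [SFinite μ] (hη : Integrable η ν)
    (hY : Measurable (Function.uncurry Y))
    (hηY : ∀ᵐ b ∂ν, η b =ᵐ[μ] fun a => Y a b) {B : Set α} (hB : μ B ≠ ∞) :
    Integrable (Function.uncurry Y) ((μ.restrict B).prod ν) := by
  rw [integrable_prod_iff' hY.aestronglyMeasurable]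
  constructor
  · filter_upwards [hηY] with b hb
    exact (integrableOn_coeFn hB (η b)).congr (ae_restrict_of_ae hb)
  · refine Integrable.mono' (hη.norm.const_mul (μ B ^ (1 - 1 / p.toReal)).toReal) ?_ ?_
    · exact (hY.stronglyMeasurable.norm.integral_prod_left' (μ := μ.restrict B)).aestronglyMeasurable
    · filter_upwards [hηY] with b hb
      have hle : ∫⁻ a in B, ‖Y a b‖ₑ ∂μ ≤ μ B ^ (1 - 1 / p.toReal) * ‖η b‖ₑ := by
        refine le_of_eq_of_le (lintegral_congr_ae (ae_restrict_of_ae ?_))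
          (lintegral_enorm_restrict_le B (η b))
        filter_upwards [hb] with a ha
        rw [ha]
      have h' := ENNReal.toReal_mono
        (ENNReal.mul_ne_top (rpow_one_sub_toReal_ne_top hB) enorm_ne_top) hle
      have hm : Measurable fun a => Function.uncurry Y (a, b) := hY.comp measurable_prodMk_right
      rw [Real.norm_of_nonneg (integral_nonneg fun _ => norm_nonneg _),
        integral_norm_eq_lintegral_enorm hm.aestronglyMeasurable]
      simpa [ENNReal.toReal_mul] using h'

/-- The Bochner integral of an `L^p`-valued function is computed pointwise from a jointly
measurable version. -/
theorem coeFn_integral_ae_eq [SigmaFinite μ] (hη : Integrable η ν)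
    (hY : Measurable (Function.uncurry Y)) (hηY : ∀ᵐ b ∂ν, η b =ᵐ[μ] fun a => Y a b) :
    (∫ b, η b ∂ν : Lp ℝ p μ) =ᵐ[μ] fun a => ∫ b, Y a b ∂ν := by
  -- Both sides are tested against sets of finite measure: the set integral commutes with the
  -- Bochner integral, and Fubini handles the right side.
  refine ae_eq_of_forall_setIntegral_eq_of_sigmaFinite
    (fun B _ hB => integrableOn_coeFn hB.ne _)
    (fun B _ hB => (integrable_uncurry_restrict hη hY hηY hB.ne).integral_prod_left) ?_
  intro B _ hB
  rw [← setIntegralCLM_apply hB.ne, ← ContinuousLinearMap.integral_comp_comm _ hη,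
    integral_integral_swap (integrable_uncurry_restrict hη hY hηY hB.ne)]
  refine integral_congr_ae ?_
  filter_upwards [hηY] with b hb
  rw [setIntegralCLM_apply]
  exact integral_congr_ae (ae_restrict_of_ae hb)

end Fubini

/-! ### Minkowski's inequality and the exchange of the two norms. -/

section Minkowski

variable {α β : Type*} [MeasurableSpace α] [MeasurableSpace β] {μ : Measure α} {ν : Measure β}

/-- **Minkowski's integral inequality**. -/
theorem lintegral_lintegral_rpow_le [SFinite μ] [IsFiniteMeasure ν] {k : ℝ} (hk : 1 ≤ k)
    {F : α → β → ℝ≥0∞} (hF : Measurable (Function.uncurry F)) :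
    (∫⁻ b, (∫⁻ a, F a b ∂μ) ^ k ∂ν) ^ (1 / k) ≤ ∫⁻ a, (∫⁻ b, F a b ^ k ∂ν) ^ (1 / k) ∂μ := by
  rcases hk.eq_or_lt with rfl | hk
  · simp only [ENNReal.rpow_one, div_one]
    exact (lintegral_lintegral_swap hF.aemeasurable).ge
  have hk0 : 0 < k := by linarith
  set R := ∫⁻ a, (∫⁻ b, F a b ^ k ∂ν) ^ (1 / k) ∂μ with hR
  set H : β → ℝ≥0∞ := fun b => ∫⁻ a, F a b ∂μ with hH
  have hHm : Measurable H := hF.lintegral_prod_left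
  have hconj : k.HolderConjugate k.conjExponent := Real.HolderConjugate.conjExponent hk
  set k' := k.conjExponent with hk'
  have hk'0 : 0 < k' := hconj.symm.pos
  have hkk : (k - 1) * k' = k := hconj.sub_one_mul_conj
  -- Truncation at `n` makes `I` finite, so that the factor `I ^ (1 / k')` produced by Hölder's
  -- inequality can be cancelled.
  have trunc : ∀ n : ℕ, ∫⁻ b, (min (H b) n) ^ k ∂ν ≤ R ^ k := by
    intro n
    set I := ∫⁻ b, (min (H b) n) ^ k ∂ν with hI
    have hIfin : I ≠ ∞ := by
      refine ne_top_of_le_ne_top (b := ∫⁻ _, (n : ℝ≥0∞) ^ k ∂ν) ?_ (lintegral_mono fun b => ?_)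
      · rw [lintegral_const]
        exact ENNReal.mul_ne_top (ENNReal.rpow_ne_top_of_nonneg hk0.le (by simp)) (by simp)
      · exact ENNReal.rpow_le_rpow (min_le_right _ _) hk0.le
    have hmin : Measurable fun b => (min (H b) n) ^ (k - 1) := (hHm.min measurable_const).pow_const _
    have h1 : I ≤ I ^ (1 / k') * R := calc
      I ≤ ∫⁻ b, (min (H b) n) ^ (k - 1) * H b ∂ν := by
        refine lintegral_mono fun b => ?_
        calc (min (H b) n) ^ k = (min (H b) n) ^ (k - 1) * (min (H b) n) ^ (1 : ℝ) := by
              rw [← ENNReal.rpow_add_of_nonneg _ _ (by linarith) zero_le_one, sub_add_cancel]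
          _ ≤ _ := by rw [ENNReal.rpow_one]; gcongr; exact min_le_left _ _
      _ = ∫⁻ b, ∫⁻ a, (min (H b) n) ^ (k - 1) * F a b ∂μ ∂ν := by
        refine lintegral_congr fun b => ?_
        rw [lintegral_const_mul _ (by fun_prop)]
      _ = ∫⁻ a, ∫⁻ b, (min (H b) n) ^ (k - 1) * F a b ∂ν ∂μ := by
        refine (lintegral_lintegral_swap ?_).symm
        exact ((hmin.comp measurable_snd).mul hF).aemeasurable
      _ ≤ ∫⁻ a, I ^ (1 / k') * (∫⁻ b, F a b ^ k ∂ν) ^ (1 / k) ∂μ := by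
        refine lintegral_mono fun a => ?_
        refine (ENNReal.lintegral_mul_le_Lp_mul_Lq ν hconj.symm hmin.aemeasurable
          (by fun_prop : Measurable fun b => F a b).aemeasurable).trans_eq ?_
        simp only [← ENNReal.rpow_mul, hkk, hI]
      _ = I ^ (1 / k') * R := by
        rw [lintegral_const_mul' _ _ (ENNReal.rpow_ne_top_of_nonneg (by positivity) hIfin)]
    rcases eq_or_ne I 0 with h0 | h0
    · simp [h0]
    have h2 : I ^ (1 / k') * I ^ (1 / k) ≤ I ^ (1 / k') * R := by
      rw [← ENNReal.rpow_add _ _ h0 hIfin]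
      have : 1 / k' + 1 / k = 1 := by simpa using hconj.symm.inv_add_inv_eq_one
      rwa [this, ENNReal.rpow_one]
    have h3 : I ^ (1 / k) ≤ R := (ENNReal.mul_le_mul_iff_right
      (by simp [ENNReal.rpow_eq_zero_iff, h0, hIfin])
      (ENNReal.rpow_ne_top_of_nonneg (by positivity) hIfin)).1 h2
    calc I = (I ^ (1 / k)) ^ k := by rw [← ENNReal.rpow_mul, one_div_mul_cancel hk0.ne',
            ENNReal.rpow_one]
      _ ≤ R ^ k := ENNReal.rpow_le_rpow h3 hk0.le
  have hsup : ∀ b, H b ^ k = ⨆ n : ℕ, (min (H b) n) ^ k := by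
    intro b
    refine le_antisymm ?_ (iSup_le fun n => ENNReal.rpow_le_rpow (min_le_left _ _) hk0.le)
    have ht : Tendsto (fun n : ℕ => (min (H b) n) ^ k) atTop (𝓝 (H b ^ k)) := by
      have h1 : Tendsto (fun n : ℕ => min (H b) n) atTop (𝓝 (min (H b) ∞)) :=
        tendsto_const_nhds.min ENNReal.tendsto_nat_nhds_top
      rw [min_eq_left le_top] at h1
      exact (ENNReal.continuous_rpow_const.tendsto _).comp h1
    exact le_of_tendsto' ht fun n => le_iSup (fun n : ℕ => (min (H b) n) ^ k) n
  have hfin : ∫⁻ b, H b ^ k ∂ν ≤ R ^ k := by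
    simp only [hsup]
    rw [lintegral_iSup (fun n => (hHm.min measurable_const).pow_const _)]
    · exact iSup_le trunc
    · intro m n hmn b
      exact ENNReal.rpow_le_rpow (min_le_min_left _ (by exact_mod_cast hmn)) hk0.le
  calc (∫⁻ b, H b ^ k ∂ν) ^ (1 / k) ≤ (R ^ k) ^ (1 / k) :=
        ENNReal.rpow_le_rpow hfin (by positivity)
    _ = R := by rw [← ENNReal.rpow_mul, mul_one_div_cancel hk0.ne', ENNReal.rpow_one]

/-- The `L^q(Ω; L^p(S))` norm is bounded by the `L^p(S; L^q(Ω))` norm if `p ≤ q`. -/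
theorem eLpNorm_le_eLpNorm_swap [SFinite μ] [IsFiniteMeasure ν] {p q : ℝ≥0∞} [hp : Fact (1 ≤ p)]
    (hpq : p ≤ q) (hq : q ≠ ∞) {Z : α → β → ℝ} (hZ : Measurable (Function.uncurry Z))
    {D : β → Lp ℝ p μ} (hD : ∀ᵐ b ∂ν, D b =ᵐ[μ] fun a => Z a b)
    {G : α → Lp ℝ q ν} (hG : ∀ᵐ a ∂μ, G a =ᵐ[ν] Z a) :
    eLpNorm D q ν ≤ eLpNorm G p μ := by
  have hp0 : p ≠ 0 := (zero_lt_one.trans_le hp.out).ne'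
  have hpt : p ≠ ∞ := ne_top_of_le_ne_top hq hpq
  have hq0 : q ≠ 0 := (zero_lt_one.trans_le (hp.out.trans hpq)).ne'
  have hpr : 0 < p.toReal := ENNReal.toReal_pos hp0 hpt
  have hqr : 0 < q.toReal := ENNReal.toReal_pos hq0 hq
  have hk : 1 ≤ q.toReal / p.toReal := by
    rw [one_le_div hpr]; exact ENNReal.toReal_mono hq hpq
  -- Minkowski is applied to `‖Z‖ ^ p` with exponent `k = q / p ≥ 1`.
  have hF : Measurable (Function.uncurry fun a b => ‖Z a b‖ₑ ^ p.toReal) :=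
    hZ.enorm.pow_const _
  have key := lintegral_lintegral_rpow_le (μ := μ) (ν := ν) hk hF
  rw [eLpNorm_eq_lintegral_rpow_enorm_toReal hq0 hq, eLpNorm_eq_lintegral_rpow_enorm_toReal hp0 hpt]
  have hDeq : ∫⁻ b, ‖D b‖ₑ ^ q.toReal ∂ν =
      ∫⁻ b, (∫⁻ a, ‖Z a b‖ₑ ^ p.toReal ∂μ) ^ (q.toReal / p.toReal) ∂ν := by
    refine lintegral_congr_ae ?_
    filter_upwards [hD] with b hb
    rw [Lp.enorm_def, eLpNorm_congr_ae hb, eLpNorm_eq_lintegral_rpow_enorm_toReal hp0 hpt,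
      ← ENNReal.rpow_mul]
    congr 1; ring
  have hGeq : ∫⁻ a, ‖G a‖ₑ ^ p.toReal ∂μ = ∫⁻ a, (∫⁻ b, (‖Z a b‖ₑ ^ p.toReal) ^
      (q.toReal / p.toReal) ∂ν) ^ (1 / (q.toReal / p.toReal)) ∂μ := by
    refine lintegral_congr_ae ?_
    filter_upwards [hG] with a ha
    rw [Lp.enorm_def, eLpNorm_congr_ae ha, eLpNorm_eq_lintegral_rpow_enorm_toReal hq0 hq,
      ← ENNReal.rpow_mul]
    simp only [← ENNReal.rpow_mul, mul_div_cancel₀ _ hpr.ne']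
    congr 1; field_simp
  rw [hDeq, hGeq]
  calc _ = ((∫⁻ b, (∫⁻ a, ‖Z a b‖ₑ ^ p.toReal ∂μ) ^ (q.toReal / p.toReal) ∂ν) ^
        (1 / (q.toReal / p.toReal))) ^ (1 / p.toReal) := by
        rw [← ENNReal.rpow_mul]; congr 1; field_simp
    _ ≤ _ := ENNReal.rpow_le_rpow key (by positivity)

end Minkowski

/-! ### Averages over disjoint families of sets. -/

section Averaging

variable {S : Type u} [MeasurableSpace S] {μ : Measure S} {𝔅 : Set (Set S)}
  {E : Type v} [NormedAddCommGroup E] [NormedSpace ℝ E]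

lemma hasSum_averaging_of_mem (hd : 𝔅.PairwiseDisjoint id) {B : Set S} (hB : B ∈ 𝔅) {s : S}
    (hs : s ∈ B) (f : S → E) :
    HasSum (fun B : 𝔅 => (B : Set S).indicator (fun _ => ⨍ t in (B : Set S), f t ∂μ) s)
      (⨍ t in B, f t ∂μ) := by
  convert hasSum_single (⟨B, hB⟩ : 𝔅) ?_ using 1
  · simp [hs]
  · rintro ⟨C, hC⟩ hne
    refine Set.indicator_of_notMem (fun hsC => hne ?_) _
    exact Subtype.ext (hd.elim_set hC hB s hsC hs)

lemma averaging_of_mem (hd : 𝔅.PairwiseDisjoint id) {B : Set S} (hB : B ∈ 𝔅) {s : S}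
    (hs : s ∈ B) (f : S → E) : averaging μ 𝔅 f s = ⨍ t in B, f t ∂μ :=
  (hasSum_averaging_of_mem hd hB hs f).tsum_eq

lemma averaging_of_forall_notMem {s : S} (hs : ∀ B ∈ 𝔅, s ∉ B) (f : S → E) :
    averaging μ 𝔅 f s = 0 := by
  have : ∀ B : 𝔅, (B : Set S).indicator (fun _ => ⨍ t in (B : Set S), f t ∂μ) s = 0 :=
    fun B => Set.indicator_of_notMem (hs B B.2) _
  simp [averaging, this]

/-- A limit of finite partial sums; countability of `𝔅` makes the filter of finite subsets countably
generated. -/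
lemma aestronglyMeasurable_averaging (hc : 𝔅.Countable) (hd : 𝔅.PairwiseDisjoint id)
    (hm : ∀ B ∈ 𝔅, MeasurableSet B) (f : S → E) :
    AEStronglyMeasurable (averaging μ 𝔅 f) μ := by
  have := hc.to_subtype
  refine aestronglyMeasurable_of_tendsto_ae (atTop : Filter (Finset 𝔅))
    (f := fun F s => ∑ B ∈ F, (B : Set S).indicator (fun _ => ⨍ t in (B : Set S), f t ∂μ) s)
    (fun F => ?_) (ae_of_all _ fun s => ?_)
  · exact Finset.aestronglyMeasurable_fun_sum _ fun B _ =>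
      aestronglyMeasurable_const.indicator (hm B B.2)
  · by_cases h : ∃ B ∈ 𝔅, s ∈ B
    · obtain ⟨B, hB, hs⟩ := h
      rw [averaging_of_mem hd hB hs]
      exact hasSum_averaging_of_mem hd hB hs f
    · push Not at h
      rw [averaging_of_forall_notMem h]
      refine tendsto_const_nhds.congr fun F => (Finset.sum_eq_zero fun B _ => ?_).symm
      exact Set.indicator_of_notMem (h B B.2) _

end Averaging

/-! ### Calculus of `L^p(S; L^q(Ω))` representatives. -/

section Swap

variable {S : Type u} [MeasurableSpace S] {μ : Measure S}
  {Ω : Type v} [MeasurableSpace Ω] {P : Measure Ω} {p q : ℝ≥0∞} [Fact (1 ≤ q)]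

lemma IsSwap.finsetSum {ι : Type*} {η : ι → Ω → Lp ℝ p μ} {g : ι → S → Lp ℝ q P}
    (h : ∀ j, IsSwap P q (η j) (g j)) (F : Finset ι) :
    IsSwap P q (fun ω => ∑ j ∈ F, η j ω) (fun s => ∑ j ∈ F, g j s) := by
  choose hg Y hY hgY using h
  refine ⟨memLp_finsetSum _ fun j _ => hg j, fun z => ∑ j ∈ F, Y j z, ⟨?_, ?_⟩, ?_⟩
  · exact Finset.measurable_sum _ fun j _ => (hY j).1
  · have := (Finset.eventually_all F).2 fun j _ => (hY j).2
    filter_upwards [this] with ω hω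
    filter_upwards [Lp.coeFn_finsetSum F fun j => η j ω, (Finset.eventually_all F).2 hω]
      with s h1 h2
    rw [h1, Finset.sum_apply]
    exact Finset.sum_congr rfl h2
  · have := (Finset.eventually_all F).2 fun j _ => hgY j
    filter_upwards [this] with s hs
    filter_upwards [Lp.coeFn_finsetSum F fun j => g j s, (Finset.eventually_all F).2 hs]
      with ω h1 h2
    rw [h1, Finset.sum_apply]
    exact Finset.sum_congr rfl h2

lemma MemSwap.exists_isSwap_of_le [IsProbabilityMeasure P] {q₁ : ℝ≥0∞} {η : Ω → Lp ℝ p μ} (h : MemSwap P q₁ η)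
    (hq₁ : q ≤ q₁) : ∃ g : S → Lp ℝ q P, IsSwap P q η g := by
  obtain ⟨_, g, hg, Y, hY, hgY⟩ := h
  refine ⟨fun s => inclusionCLM hq₁ (g s), hg.continuousLinearMap_comp _, Y, hY, ?_⟩
  filter_upwards [hgY] with s hs
  exact (coeFn_inclusionCLM hq₁ (g s)).trans hs

variable [SigmaFinite μ] [IsProbabilityMeasure P] [hp : Fact (1 ≤ p)]

/-- Fubini with the roles of `S` and `Ω` exchanged. The right side depends on `η ω` only through a
continuous functional, which is how independence and laws reach the averages of `g`. -/
lemma coeFn_setAverage_swap {η : Ω → Lp ℝ p μ} {g : S → Lp ℝ q P} (h : IsSwap P q η g)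
    {B : Set S} (hB : μ B ≠ ∞) :
    (⨍ s in B, g s ∂μ : Lp ℝ q P) =ᵐ[P]
      fun ω => (μ.real B)⁻¹ * setIntegralCLM p B hB (η ω) := by
  obtain ⟨hg, Y, ⟨hYm, hηY⟩, hgY⟩ := h
  have : IsFiniteMeasure (μ.restrict B) := ⟨by simpa using hB.lt_top⟩
  have hint : Integrable g (μ.restrict B) := (hg.restrict B).integrable hp.out
  have hswap := coeFn_integral_ae_eq (Y := fun ω s => Y (s, ω)) hint
    (hYm.comp measurable_swap) (ae_restrict_of_ae hgY)
  rw [setAverage_eq]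
  filter_upwards [Lp.coeFn_smul (μ.real B)⁻¹ (∫ s in B, g s ∂μ : Lp ℝ q P), hswap, hηY]
    with ω h1 h2 h3
  rw [h1, Pi.smul_apply, h2, smul_eq_mul, setIntegralCLM_apply]
  congr 1
  exact (integral_congr_ae (ae_restrict_of_ae h3)).symm

/-- The Bochner mean of `η` is computed pointwise from `Y`, so centring in `L^p(S)` agrees with
centring each `g s` in `L^q(Ω)`. -/
lemma IsSwap.center {η : Ω → Lp ℝ p μ} {g : S → Lp ℝ q P} (h : IsSwap P q η g)
    (hη : Integrable η P) :
    IsSwap P q (fun ω => η ω - ∫ ω', η ω' ∂P) (fun s => centerCLM q P (g s)) := by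
  obtain ⟨hg, Y, ⟨hYm, hηY⟩, hgY⟩ := h
  refine ⟨hg.continuousLinearMap_comp _, fun z => Y z - ∫ ω, Y (z.1, ω) ∂P, ⟨?_, ?_⟩, ?_⟩
  · exact hYm.sub (hYm.stronglyMeasurable.integral_prod_right'.measurable.comp measurable_fst)
  · have hmean := coeFn_integral_ae_eq (Y := fun s ω => Y (s, ω)) hη hYm hηY
    filter_upwards [hηY] with ω hω
    filter_upwards [Lp.coeFn_sub (η ω) (∫ ω', η ω' ∂P), hω, hmean] with s h1 h2 h3
    rw [h1, Pi.sub_apply, h2, h3]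
  · filter_upwards [hgY] with s hs
    filter_upwards [coeFn_centerCLM (g s), hs] with ω h1 h2
    rw [h1, h2, integral_congr_ae hs]

lemma IsSwap.eLpNorm_le {η : Ω → Lp ℝ p μ} {g : S → Lp ℝ q P} (h : IsSwap P q η g)
    (hpq : p ≤ q) (hqt : q ≠ ∞) : eLpNorm η q P ≤ eLpNorm g p μ := by
  obtain ⟨-, Y, ⟨hYm, hηY⟩, hgY⟩ := h
  exact eLpNorm_le_eLpNorm_swap (Z := fun s ω => Y (s, ω)) hpq hqt hYm hηY hgY

end Swap

/-! ### Statistical error of sample means. -/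

section Sampling

variable {S : Type u} [MeasurableSpace S] {μ : Measure S} [SigmaFinite μ]
  {Ω : Type v} [MeasurableSpace Ω] {P : Measure Ω} [IsProbabilityMeasure P]
  {p : ℝ≥0∞} [hp : Fact (1 ≤ p)] [MeasurableSpace (Lp ℝ p μ)] [BorelSpace (Lp ℝ p μ)]

/-- The `L^p(S; L^t(Ω))` norm of a sum of independent copies of a centred random variable. -/
theorem eLpNorm_sum_swap_le (hav : ApproxByAveraging.{u, v} μ) (hpt : p ≠ ∞) {t : ℝ}
    [Fact (1 ≤ ENNReal.ofReal t)] (ht : 1 < t) (ht2 : t ≤ 2)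
    {η₀ : Ω → Lp ℝ p μ} {g₀ : S → Lp ℝ (ENNReal.ofReal t) P}
    (h₀ : IsSwap P (ENNReal.ofReal t) η₀ g₀) (hint : Integrable η₀ P) (hmean : ∫ ω, η₀ ω ∂P = 0)
    {η : ℕ → Ω → Lp ℝ p μ} {g : ℕ → S → Lp ℝ (ENNReal.ofReal t) P}
    (h : ∀ j, IsSwap P (ENNReal.ofReal t) (η j) (g j)) (hind : iIndepFun η P)
    (hid : ∀ j, IdentDistrib (η j) η₀ P P) (m : ℕ) :
    eLpNorm (fun s => ∑ j ∈ Finset.range m, g j s) p μ ≤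
      ENNReal.ofReal ((4 * m) ^ t⁻¹) * eLpNorm g₀ p μ := by
  -- The property is used with `E = L^t(Ω)`, which lives in the universe of `Ω`.
  obtain ⟨𝔅, h𝔅, hconv⟩ := hav
  have onSet : ∀ B : Set S, μ B ≠ ∞ → ‖∑ j ∈ Finset.range m, ⨍ s in B, g j s ∂μ‖ ≤
      (4 * m) ^ t⁻¹ * ‖⨍ s in B, g₀ s ∂μ‖ := by
    intro B hB
    set Φ : Lp ℝ p μ → ℝ := fun f => (μ.real B)⁻¹ * setIntegralCLM p B hB f with hΦ
    have hΦm : Measurable Φ := by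
      refine Continuous.measurable ?_
      fun_prop
    have hV : MemLp (Φ ∘ η₀) (ENNReal.ofReal t) P :=
      (memLp_congr_ae (coeFn_setAverage_swap h₀ hB)).1 (Lp.memLp _)
    have hVmean : ∫ ω, (Φ ∘ η₀) ω ∂P = 0 := by
      simp only [hΦ, Function.comp_apply]
      rw [integral_const_mul, ContinuousLinearMap.integral_comp_comm _ hint, hmean, map_zero,
        mul_zero]
    have key := eLpNorm_sum_le_of_identDistrib ht ht2 hV
      (hind.comp (fun _ => Φ) fun _ => hΦm) (fun j => (hid j).comp hΦm) hVmean m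
    have hsum : eLpNorm (fun ω => ∑ j ∈ Finset.range m, (Φ ∘ η j) ω) (ENNReal.ofReal t) P =
        eLpNorm (∑ j ∈ Finset.range m, ⨍ s in B, g j s ∂μ : Lp ℝ (ENNReal.ofReal t) P)
          (ENNReal.ofReal t) P := by
      refine eLpNorm_congr_ae ?_
      filter_upwards [Lp.coeFn_finsetSum (Finset.range m) fun j => ⨍ s in B, g j s ∂μ,
        (Finset.eventually_all (Finset.range m)).2 fun j _ => coeFn_setAverage_swap (h j) hB]
        with ω h1 h2
      rw [h1, Finset.sum_apply]
      exact (Finset.sum_congr rfl h2).symm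
    have hV' : eLpNorm (Φ ∘ η₀) (ENNReal.ofReal t) P =
        eLpNorm (⨍ s in B, g₀ s ∂μ : Lp ℝ (ENNReal.ofReal t) P) (ENNReal.ofReal t) P :=
      (eLpNorm_congr_ae (coeFn_setAverage_swap h₀ hB)).symm
    rw [hsum, hV', ← Lp.enorm_def, ← Lp.enorm_def]
      at key
    have := ENNReal.toReal_mono (ENNReal.mul_ne_top ENNReal.ofReal_ne_top enorm_ne_top) key
    rwa [ENNReal.toReal_mul, ENNReal.toReal_ofReal (by positivity), toReal_enorm, toReal_enorm]
      at this
  set c := ENNReal.ofReal ((4 * m) ^ t⁻¹) with hc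
  have hmeas : ∀ n (f : S → Lp ℝ (ENNReal.ofReal t) P),
      AEStronglyMeasurable (averaging μ (𝔅 n) f) μ := fun n f =>
    aestronglyMeasurable_averaging (h𝔅 n).1 (h𝔅 n).2.1 (fun B hB => ((h𝔅 n).2.2 B hB).1) f
  have step : ∀ n, eLpNorm (fun s => ∑ j ∈ Finset.range m, g j s) p μ ≤
      ∑ j ∈ Finset.range m, eLpNorm (g j - averaging μ (𝔅 n) (g j)) p μ +
        c * (eLpNorm g₀ p μ + eLpNorm (g₀ - averaging μ (𝔅 n) g₀) p μ) := by
    intro n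
    have e1 : (fun s => ∑ j ∈ Finset.range m, g j s) =
        (∑ j ∈ Finset.range m, (g j - averaging μ (𝔅 n) (g j))) +
          fun s => ∑ j ∈ Finset.range m, averaging μ (𝔅 n) (g j) s := by
      ext1 s
      simp [Finset.sum_apply]
    have e2 : averaging μ (𝔅 n) g₀ = g₀ - (g₀ - averaging μ (𝔅 n) g₀) := by simp
    have b2 : eLpNorm (averaging μ (𝔅 n) g₀) p μ ≤
        eLpNorm g₀ p μ + eLpNorm (g₀ - averaging μ (𝔅 n) g₀) p μ := by
      conv_lhs => rw [e2]
      exact eLpNorm_sub_le h₀.1.1 (h₀.1.1.sub (hmeas n _)) hp.out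
    have b3 : eLpNorm (fun s => ∑ j ∈ Finset.range m, averaging μ (𝔅 n) (g j) s) p μ ≤
        c * eLpNorm (averaging μ (𝔅 n) g₀) p μ := by
      -- Averages are constant on each `B`, where `onSet` applies, and vanish off the family.
      refine eLpNorm_le_mul_eLpNorm_of_ae_le_mul (ae_of_all _ fun s => ?_) p
      by_cases hs : ∃ B ∈ 𝔅 n, s ∈ B
      · obtain ⟨B, hB, hs⟩ := hs
        simp only [averaging_of_mem (h𝔅 n).2.1 hB hs]
        exact onSet B ((h𝔅 n).2.2 B hB).2.2.ne
      · push Not at hs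
        simp [averaging_of_forall_notMem hs]
    rw [e1]
    refine (eLpNorm_add_le ?_ ?_ hp.out).trans (add_le_add ?_ (b3.trans (by gcongr)))
    · exact Finset.aestronglyMeasurable_sum _ fun j _ => (h j).1.1.sub (hmeas n _)
    · exact Finset.aestronglyMeasurable_fun_sum _ fun j _ => hmeas n _
    · exact eLpNorm_sum_le (fun j _ => (h j).1.1.sub (hmeas n _)) hp.out
  have hlim : Tendsto (fun n => ∑ j ∈ Finset.range m, eLpNorm (g j - averaging μ (𝔅 n) (g j)) p μ +
        c * (eLpNorm g₀ p μ + eLpNorm (g₀ - averaging μ (𝔅 n) g₀) p μ)) atTop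
      (𝓝 (∑ _j ∈ Finset.range m, 0 + c * (eLpNorm g₀ p μ + 0))) := by
    refine (tendsto_finsetSum _ fun j _ => hconv _ p hp.out hpt (g j) (h j).1).add ?_
    refine ENNReal.Tendsto.const_mul (tendsto_const_nhds.add ?_) (Or.inr ENNReal.ofReal_ne_top)
    exact hconv _ p hp.out hpt g₀ h₀.1
  have := ge_of_tendsto' hlim step
  simpa using this

/-- The statistical error of the sample mean of `m` independent copies. -/
theorem eLpNorm_sampleMean_sub_le (hav : ApproxByAveraging.{u, v} μ) {q t : ℝ}
    (hq : 1 < q) (hpq : p ≤ ENNReal.ofReal q) (hqt : q ≤ t) (ht2 : t ≤ 2)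
    {ξ₀ : Ω → Lp ℝ p μ} (hint : Integrable ξ₀ P) {ξ : ℕ → Ω → Lp ℝ p μ}
    (hξ : ∀ j, MemSwap P (ENNReal.ofReal t) (ξ j)) (hind : iIndepFun ξ P)
    (hid : ∀ j, IdentDistrib (ξ j) ξ₀ P P) {m : ℕ} (hm : 1 ≤ m) :
    eLpNorm (fun ω => (1 / (m : ℝ)) • (∑ j ∈ Finset.range m, ξ j ω) - ∫ ω', ξ₀ ω' ∂P)
      (ENNReal.ofReal q) P ≤ ENNReal.ofReal (4 * (m : ℝ) ^ (-(1 - t⁻¹))) *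
        swapNorm P (ENNReal.ofReal t) fun ω => ξ₀ ω - ∫ ω', ξ₀ ω' ∂P := by
  have ht : 1 < t := hq.trans_le hqt
  have : Fact (1 ≤ ENNReal.ofReal t) :=
    ⟨by rw [← ENNReal.ofReal_one]; exact ENNReal.ofReal_le_ofReal ht.le⟩
  have hpt : p ≠ ∞ := ne_top_of_le_ne_top ENNReal.ofReal_ne_top hpq
  have hqt' : ENNReal.ofReal q ≤ ENNReal.ofReal t := ENNReal.ofReal_le_ofReal hqt
  set e := ∫ ω', ξ₀ ω' ∂P with he
  have hintj : ∀ j, Integrable (ξ j) P := fun j => by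
    rw [← memLp_one_iff_integrable] at hint ⊢
    exact (hid j).memLp_iff.2 hint
  have hej : ∀ j, ∫ ω, ξ j ω ∂P = e := fun j => (hid j).integral_eq
  have hsub : Measurable fun f : Lp ℝ p μ => f - e := (continuous_id.sub continuous_const).measurable
  choose g hg using fun j => (hξ j).exists_isSwap_of_le (q := ENNReal.ofReal t) le_rfl
  have hgc : ∀ j, IsSwap P (ENNReal.ofReal t) (fun ω => ξ j ω - e)
      (fun s => centerCLM (ENNReal.ofReal t) P (g j s)) := fun j => by
    simpa only [hej] using (hg j).center (hintj j)
  set c := ENNReal.ofReal (4 * (m : ℝ) ^ (-(1 - t⁻¹))) with hc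
  have hm0 : (0 : ℝ) < m := by exact_mod_cast hm
  have hc0 : c ≠ 0 := by
    rw [hc, Ne, ENNReal.ofReal_eq_zero, not_le]; positivity
  have main : ∀ g₀ : S → Lp ℝ (ENNReal.ofReal t) P,
      IsSwap P (ENNReal.ofReal t) (fun ω => ξ₀ ω - e) g₀ →
      eLpNorm (fun ω => (1 / (m : ℝ)) • (∑ j ∈ Finset.range m, ξ j ω) - e)
        (ENNReal.ofReal q) P ≤ c * eLpNorm g₀ p μ := by
    intro g₀ h₀
    have hmean : ∫ ω, (ξ₀ ω - e) ∂P = 0 := by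
      rw [integral_sub hint (integrable_const _)]; simp [he]
    have h1 := eLpNorm_sum_swap_le hav hpt ht ht2 h₀ (hint.sub (integrable_const _)) hmean hgc
      (hind.comp (fun _ => fun f => f - e) fun _ => hsub) (fun j => (hid j).comp hsub) m
    have h2 := (IsSwap.finsetSum hgc (Finset.range m)).eLpNorm_le (hpq.trans hqt')
      ENNReal.ofReal_ne_top
    have hmeas : AEStronglyMeasurable (fun ω => ∑ j ∈ Finset.range m, (ξ j ω - e)) P :=
      Finset.aestronglyMeasurable_fun_sum _ fun j _ => (hintj j).1.sub aestronglyMeasurable_const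
    -- From `L^q(Ω)` to `L^t(Ω)` over a probability measure, then Minkowski, then the bound for
    -- sums.
    have h3 := (eLpNorm_le_eLpNorm_of_exponent_le hqt' hmeas).trans (h2.trans h1)
    have e1 : (fun ω => (1 / (m : ℝ)) • (∑ j ∈ Finset.range m, ξ j ω) - e) =
        (1 / (m : ℝ)) • fun ω => ∑ j ∈ Finset.range m, (ξ j ω - e) := by
      ext1 ω
      rw [Pi.smul_apply, Finset.sum_sub_distrib, smul_sub, Finset.sum_const, Finset.card_range,
        ← Nat.cast_smul_eq_nsmul ℝ, smul_smul, one_div_mul_cancel hm0.ne', one_smul]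
    rw [e1, eLpNorm_const_smul, Real.enorm_of_nonneg (by positivity)]
    refine (mul_le_mul_right h3 _).trans ?_
    rw [← mul_assoc, ← ENNReal.ofReal_mul (by positivity)]
    refine mul_le_mul_left (ENNReal.ofReal_le_ofReal ?_) _
    have h4 : (4 : ℝ) ^ t⁻¹ ≤ 4 := by
      conv_rhs => rw [← Real.rpow_one 4]
      exact Real.rpow_le_rpow_of_exponent_le (by norm_num) (inv_le_one_of_one_le₀ ht.le)
    rw [Real.mul_rpow (by norm_num) hm0.le, neg_sub, Real.rpow_sub_one hm0.ne']
    calc 1 / (m : ℝ) * (4 ^ t⁻¹ * (m : ℝ) ^ t⁻¹) = 4 ^ t⁻¹ * ((m : ℝ) ^ t⁻¹ / m) := by ring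
      _ ≤ 4 * ((m : ℝ) ^ t⁻¹ / m) := by gcongr
  -- Dividing by `c` isolates the infimum defining `swapNorm`, so it suffices to treat each
  -- representative; without one the bound is `∞`.
  rw [mul_comm, ← ENNReal.div_le_iff_le_mul (Or.inl hc0) (Or.inl ENNReal.ofReal_ne_top)]
  refine le_iInf fun _ => le_iInf fun g₀ => le_iInf fun h₀ => ?_
  rw [ENNReal.div_le_iff_le_mul (Or.inl hc0) (Or.inl ENNReal.ofReal_ne_top), mul_comm]
  exact main g₀ h₀

end Sampling

/-! ### Choice of levels and sample numbers. -/

section Parameters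

variable {A : ℝ}

lemma sum_Icc_rpow_neg_le (hA : 1 < A) {δ : ℝ} (hδ : 0 < δ) (L : ℕ) :
    ∑ l ∈ Finset.Icc 1 L, A ^ (-(δ * l)) ≤ (1 - A ^ (-δ))⁻¹ := by
  have hA0 : 0 < A := by linarith
  have hx0 : 0 ≤ A ^ (-δ) := by positivity
  have hx1 : A ^ (-δ) < 1 := Real.rpow_lt_one_of_one_lt_of_neg hA (by linarith)
  rw [← tsum_geometric_of_lt_one hx0 hx1]
  refine le_of_eq_of_le (Finset.sum_congr rfl fun l _ => ?_)
    ((summable_geometric_of_lt_one hx0 hx1).sum_le_tsum _ fun _ _ => by positivity)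
  rw [← Real.rpow_natCast, ← Real.rpow_mul hA0.le, neg_mul]

lemma sum_Icc_rpow_neg_sub_le (hA : 1 < A) {δ : ℝ} (hδ : 0 < δ) (L : ℕ) :
    ∑ l ∈ Finset.Icc 1 L, A ^ (-(δ * (L - l))) ≤ (1 - A ^ (-δ))⁻¹ := by
  have hA0 : 0 < A := by linarith
  have hx0 : 0 ≤ A ^ (-δ) := by positivity
  have hx1 : A ^ (-δ) < 1 := Real.rpow_lt_one_of_one_lt_of_neg hA (by linarith)
  rw [← tsum_geometric_of_lt_one hx0 hx1]
  have hinj : Set.InjOn (fun l => L - l) (Finset.Icc 1 L : Finset ℕ) := by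
    intro a ha b hb h
    simp only [Finset.coe_Icc, Set.mem_Icc] at ha hb h
    omega
  calc ∑ l ∈ Finset.Icc 1 L, A ^ (-(δ * (L - l))) = ∑ l ∈ Finset.Icc 1 L, (A ^ (-δ)) ^ (L - l) := by
        refine Finset.sum_congr rfl fun l hl => ?_
        rw [← Real.rpow_natCast, ← Real.rpow_mul hA0.le, Nat.cast_sub (Finset.mem_Icc.1 hl).2,
          neg_mul]
    _ = ∑ k ∈ (Finset.Icc 1 L).image (fun l => L - l), (A ^ (-δ)) ^ k := by
        rw [Finset.sum_image hinj]
    _ ≤ _ := (summable_geometric_of_lt_one hx0 hx1).sum_le_tsum _ fun _ _ => by positivity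

lemma one_sub_rpow_neg_inv_pos (hA : 1 < A) {δ : ℝ} (hδ : 0 < δ) : 0 < (1 - A ^ (-δ))⁻¹ :=
  inv_pos.2 (sub_pos.2 (Real.rpow_lt_one_of_one_lt_of_neg hA (by linarith)))

/-- The finest level: the bias is at most `ε / 4`, while `A ^ L` is of order `ε ^ (-1 / α)`. -/
lemma exists_finest_level (hA : 1 < A) {α Ca : ℝ} (hα : 0 < α) (hCa : 0 < Ca) :
    ∃ D : ℝ, 0 < D ∧ ∀ ε ∈ Set.Ioc (0 : ℝ) (1 / 2), ∃ L : ℕ, 1 ≤ L ∧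
      Ca * A ^ (-(α * L)) ≤ ε / 4 ∧ A ^ (L : ℝ) ≤ D * ε ^ (-(1 / α)) ∧
      L ≤ D * |Real.logb A ε| := by
  have hA0 : 0 < A := by linarith
  -- The bound `A ≤ D₀` forces `L ≥ 1`; the other entry of the maximum yields the bias bound.
  set D₀ := max A ((4 * Ca) ^ (1 / α)) with hD₀
  have hD₀A : A ≤ D₀ := le_max_left _ _
  have hD₀0 : 0 < D₀ := hA0.trans_le hD₀A
  -- As `ε ≤ 1 / 2`, `κ` is a lower bound for `|Real.logb A ε|`, so additive constants in `L` are
  -- absorbed.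
  set κ := Real.logb A 2 with hκ
  have hκ0 : 0 < κ := Real.logb_pos hA (by norm_num)
  have hlD : 0 ≤ Real.logb A D₀ := Real.logb_nonneg hA (by linarith)
  refine ⟨max (A * D₀) ((1 + Real.logb A D₀) / κ + 1 / α), lt_max_of_lt_left (by positivity), ?_⟩
  rintro ε ⟨hε0, hε2⟩
  have hε1 : ε ≤ 1 := by linarith
  set x := D₀ * ε ^ (-(1 / α)) with hx
  have hεp : 1 ≤ ε ^ (-(1 / α)) :=
    Real.one_le_rpow_of_pos_of_le_one_of_nonpos hε0 hε1 (by simp; positivity)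
  have hx0 : 0 < x := by positivity
  have hAx : A ≤ x := hD₀A.trans (le_mul_of_one_le_right hD₀0.le hεp)
  have hlx : 1 ≤ Real.logb A x := by
    rw [← Real.logb_self_eq_one hA]
    exact Real.logb_le_logb_of_le hA hA0 hAx
  have hlog : Real.logb A x = Real.logb A D₀ + 1 / α * |Real.logb A ε| := by
    rw [hx, Real.logb_mul hD₀0.ne' (by positivity), Real.logb_rpow_eq_mul_logb_of_pos hε0,
      abs_of_nonpos (Real.logb_nonpos hA hε0.le hε1)]
    ring
  have hκle : κ ≤ |Real.logb A ε| := by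
    rw [abs_of_nonpos (Real.logb_nonpos hA hε0.le hε1), ← Real.logb_inv]
    refine Real.logb_le_logb_of_le hA (by norm_num) ?_
    rw [le_inv_comm₀ (by norm_num) hε0]
    linarith
  set L := ⌈Real.logb A x⌉₊ with hL
  have hLge : Real.logb A x ≤ L := Nat.le_ceil _
  have hLlt : (L : ℝ) < Real.logb A x + 1 := Nat.ceil_lt_add_one (by linarith)
  refine ⟨L, ?_, ?_, ?_, ?_⟩
  · exact_mod_cast hlx.trans hLge
  · have h1 : x ≤ A ^ (L : ℝ) := (Real.logb_le_iff_le_rpow hA hx0).1 hLge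
    have h2 : A ^ (-(α * L)) = (A ^ (L : ℝ)) ^ (-α) := by
      rw [← Real.rpow_mul hA0.le]; congr 1; ring
    have h3 : (A ^ (L : ℝ)) ^ (-α) ≤ x ^ (-α) :=
      Real.rpow_le_rpow_of_nonpos hx0 h1 (by linarith)
    have h4 : x ^ (-α) = D₀ ^ (-α) * ε := by
      rw [hx, Real.mul_rpow hD₀0.le (by positivity), ← Real.rpow_mul hε0.le]
      congr 1
      rw [show -(1 / α) * -α = 1 by field_simp, Real.rpow_one]
    have h5 : D₀ ^ (-α) ≤ (4 * Ca)⁻¹ := by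
      calc D₀ ^ (-α) ≤ ((4 * Ca) ^ (1 / α)) ^ (-α) :=
            Real.rpow_le_rpow_of_nonpos (by positivity) (le_max_right _ _) (by linarith)
        _ = (4 * Ca)⁻¹ := by
            rw [← Real.rpow_mul (by positivity), show 1 / α * -α = -1 by field_simp,
              Real.rpow_neg_one]
    calc Ca * A ^ (-(α * L)) ≤ Ca * ((4 * Ca)⁻¹ * ε) := by
          rw [h2]
          gcongr
          exact h3.trans (h4.trans_le (by gcongr))
      _ = ε / 4 := by field_simp
  · calc A ^ (L : ℝ) ≤ A ^ (Real.logb A x + 1) :=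
          Real.rpow_le_rpow_of_exponent_le hA.le hLlt.le
      _ = A * D₀ * ε ^ (-(1 / α)) := by
          rw [Real.rpow_add_one hA0.ne', Real.rpow_logb hA0 hA.ne' hx0, hx]; ring
      _ ≤ _ := by gcongr; exact le_max_left _ _
  · calc (L : ℝ) ≤ 1 + Real.logb A D₀ + 1 / α * |Real.logb A ε| := by linarith
      _ ≤ (1 + Real.logb A D₀) / κ * |Real.logb A ε| + 1 / α * |Real.logb A ε| := by
          gcongr
          rw [div_mul_eq_mul_div, le_div_iff₀ hκ0]
          gcongr
      _ = ((1 + Real.logb A D₀) / κ + 1 / α) * |Real.logb A ε| := by ring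
      _ ≤ _ := by gcongr; exact le_max_right _ _

/-- Sample numbers obtained from weights `v` distributing the statistical error over the levels. -/
lemma exists_samples_of_weights (hA : 1 < A) {b γ s Cb V ε : ℝ} (hs : 0 < s) (hCb : 0 < Cb)
    (hV : 0 < V) (hε : 0 < ε) (L : ℕ) {v : ℕ → ℝ} (hv : ∀ l, 0 < v l)
    (hvV : ∑ l ∈ Finset.Icc 1 L, (v l)⁻¹ ≤ V) :
    ∃ M : ℕ → ℕ, (∀ l, 1 ≤ M l) ∧
      ∑ l ∈ Finset.Icc 1 L, Cb * (M l : ℝ) ^ (-s⁻¹) * A ^ (-(b * l)) ≤ ε / 4 ∧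
      ∑ l ∈ Finset.Icc 1 L, A ^ (γ * l) * (M l : ℝ) ≤ ∑ l ∈ Finset.Icc 1 L, A ^ (γ * l) +
        (4 * Cb * V) ^ s * (ε ^ (-s) * ∑ l ∈ Finset.Icc 1 L, v l ^ s * A ^ ((γ - b * s) * l)) := by
  have hA0 : 0 < A := by linarith
  set T := 4 * Cb * V with hT
  have hT0 : 0 < T := by positivity
  -- With `y l ^ s` samples, level `l` contributes exactly `Cb * ε / (T * v l)`; the value of `T`
  -- makes these sum to at most `ε / 4`.
  set y : ℕ → ℝ := fun l => T * v l * A ^ (-(b * l)) / ε with hy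
  have hy0 : ∀ l, 0 < y l := fun l => by have := hv l; positivity
  refine ⟨fun l => ⌈y l ^ s⌉₊, fun l => ?_, ?_, ?_⟩
  · exact Nat.one_le_iff_ne_zero.2 (Nat.ceil_pos.2 (Real.rpow_pos_of_pos (hy0 l) s)).ne'
  · calc ∑ l ∈ Finset.Icc 1 L, Cb * (⌈y l ^ s⌉₊ : ℝ) ^ (-s⁻¹) * A ^ (-(b * l))
        ≤ ∑ l ∈ Finset.Icc 1 L, Cb * ε / T * (v l)⁻¹ := by
          refine Finset.sum_le_sum fun l _ => ?_
          have h1 : (⌈y l ^ s⌉₊ : ℝ) ^ (-s⁻¹) ≤ (y l ^ s) ^ (-s⁻¹) :=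
            Real.rpow_le_rpow_of_nonpos (Real.rpow_pos_of_pos (hy0 l) s) (Nat.le_ceil _)
              (by simp; positivity)
          have h2 : (y l ^ s) ^ (-s⁻¹) = (y l)⁻¹ := by
            rw [← Real.rpow_mul (hy0 l).le, mul_neg, mul_inv_cancel₀ hs.ne', Real.rpow_neg_one]
          rw [h2] at h1
          have hvl := hv l
          have hAl : 0 < A ^ (-(b * l)) := by positivity
          calc Cb * (⌈y l ^ s⌉₊ : ℝ) ^ (-s⁻¹) * A ^ (-(b * l))
              ≤ Cb * (y l)⁻¹ * A ^ (-(b * l)) := by gcongr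
            _ = Cb * ε / T * (v l)⁻¹ := by simp only [hy]; field_simp
      _ ≤ Cb * ε / T * V := by rw [← Finset.mul_sum]; gcongr
      _ = ε / 4 := by rw [hT]; field_simp
  · rw [Finset.mul_sum, Finset.mul_sum, ← Finset.sum_add_distrib]
    refine Finset.sum_le_sum fun l _ => ?_
    have hvl := hv l
    -- Rounding up adds at most one sample per level, which is the source of the term `∑ A ^ (γ *
    -- l)`.
    have h1 : (⌈y l ^ s⌉₊ : ℝ) ≤ y l ^ s + 1 :=
      (Nat.ceil_lt_add_one (Real.rpow_nonneg (hy0 l).le s)).le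
    have h2 : A ^ (γ * l) * y l ^ s =
        T ^ s * (ε ^ (-s) * (v l ^ s * A ^ ((γ - b * s) * l))) := by
      simp only [hy]
      rw [Real.div_rpow (by positivity) hε.le, Real.mul_rpow (by positivity) (by positivity),
        Real.mul_rpow hT0.le hvl.le, ← Real.rpow_mul hA0.le, Real.rpow_neg hε.le,
        show (γ - b * s) * l = γ * l + -(b * l) * s by ring, Real.rpow_add hA0]
      ring
    calc A ^ (γ * l) * (⌈y l ^ s⌉₊ : ℝ) ≤ A ^ (γ * l) * (y l ^ s + 1) := by gcongr
      _ = _ := by rw [mul_add, h2, mul_one, add_comm]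

/-- The part of `costOrder` that is due to the statistical error. -/
noncomputable def statisticalCost (α b γ A s ε : ℝ) : ℝ :=
  if γ / s < b then ε ^ (-s)
  else if b = γ / s then ε ^ (-s) * |Real.logb A ε| ^ (s + 1)
  else ε ^ (-s - (γ - b * s) / α)

lemma costOrder_eq (α b γ A s ε : ℝ) :
    costOrder α b γ A s ε = ε ^ (-(γ / α)) + statisticalCost α b γ A s ε := by
  unfold costOrder statisticalCost
  split_ifs <;> rfl

lemma statisticalCost_nonneg {α b γ A s ε : ℝ} (hε : 0 ≤ ε) :
    0 ≤ statisticalCost α b γ A s ε := by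
  unfold statisticalCost
  split_ifs <;> positivity

/-- The reciprocals of the weights must have a sum bounded independently of `L`, while `v l ^ s`
inflates the cost of each level; the sign of `γ - b * s` decides the shape. -/
lemma exists_weights (hA : 1 < A) {α b γ s D : ℝ} (hs : 0 < s) (hD : 0 < D) :
    ∃ V W : ℝ, 0 < V ∧ 0 < W ∧ ∀ ε ∈ Set.Ioc (0 : ℝ) (1 / 2), ∀ L : ℕ, 1 ≤ L →
      A ^ (L : ℝ) ≤ D * ε ^ (-(1 / α)) → L ≤ D * |Real.logb A ε| →
      ∃ v : ℕ → ℝ, (∀ l, 0 < v l) ∧ ∑ l ∈ Finset.Icc 1 L, (v l)⁻¹ ≤ V ∧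
        ε ^ (-s) * ∑ l ∈ Finset.Icc 1 L, v l ^ s * A ^ ((γ - b * s) * l) ≤
          W * statisticalCost α b γ A s ε := by
  have hA0 : 0 < A := by linarith
  rcases lt_trichotomy (γ / s) b with hb | hb | hb
  · have hpos : 0 < b * s - γ := by rw [div_lt_iff₀ hs] at hb; linarith
    -- Half of the decay pays for the growing weights; the other half keeps the cost summable.
    set δ := (b * s - γ) / (2 * s) with hδ
    have hδ0 : 0 < δ := by positivity
    have hδs : γ - b * s = -(2 * (δ * s)) := by rw [hδ]; field_simp; ring
    refine ⟨_, _, one_sub_rpow_neg_inv_pos hA hδ0,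
      one_sub_rpow_neg_inv_pos hA (mul_pos hδ0 hs), ?_⟩
    rintro ε ⟨hε0, -⟩ L - - -
    refine ⟨fun l => A ^ (δ * l), fun l => by positivity, ?_, ?_⟩
    · simpa only [← Real.rpow_neg hA0.le] using sum_Icc_rpow_neg_le hA hδ0 L
    · rw [statisticalCost, if_pos hb, mul_comm]
      gcongr
      refine le_of_eq_of_le (Finset.sum_congr rfl fun l _ => ?_)
        (sum_Icc_rpow_neg_le hA (mul_pos hδ0 hs) L)
      rw [← Real.rpow_mul hA0.le, ← Real.rpow_add hA0, hδs]
      congr 1; ring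
  · have hz : γ - b * s = 0 := by rw [← hb]; field_simp; ring
    refine ⟨1, D ^ (s + 1), one_pos, by positivity, ?_⟩
    rintro ε ⟨hε0, -⟩ L hL - hLlog
    have hL0 : (0 : ℝ) < L := by exact_mod_cast hL
    -- No level dominates, so the weights are equal; `L` levels costing `L ^ s` each explain the
    -- exponent `s + 1` of the logarithm.
    refine ⟨fun _ => L, fun _ => hL0, ?_, ?_⟩
    · simp [hL0.ne']
    · rw [statisticalCost, if_neg hb.symm.not_gt, if_pos hb.symm]
      simp only [hz, zero_mul, Real.rpow_zero, mul_one, Finset.sum_const, Nat.card_Icc,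
        add_tsub_cancel_right, nsmul_eq_mul]
      calc ε ^ (-s) * (L * (L : ℝ) ^ s) = ε ^ (-s) * (L : ℝ) ^ (s + 1) := by
            rw [Real.rpow_add_one hL0.ne']; ring
        _ ≤ ε ^ (-s) * (D * |Real.logb A ε|) ^ (s + 1) := by gcongr
        _ = _ := by rw [Real.mul_rpow hD.le (abs_nonneg _)]; ring
  · have hpos : 0 < γ - b * s := by rw [lt_div_iff₀ hs] at hb; linarith
    set δ := (γ - b * s) / (2 * s) with hδ
    have hδ0 : 0 < δ := by positivity
    have hδs : γ - b * s = 2 * (δ * s) := by rw [hδ]; field_simp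
    have hG := one_sub_rpow_neg_inv_pos hA (mul_pos hδ0 hs)
    refine ⟨_, (1 - A ^ (-(δ * s)))⁻¹ * D ^ (γ - b * s), one_sub_rpow_neg_inv_pos hA hδ0,
      by positivity, ?_⟩
    rintro ε ⟨hε0, -⟩ L - hLA -
    -- The mirror image of the first case: the finest level dominates the cost, and the weights grow
    -- towards the coarse levels.
    refine ⟨fun l => A ^ (δ * (L - l)), fun l => by positivity, ?_, ?_⟩
    · simpa only [← Real.rpow_neg hA0.le] using sum_Icc_rpow_neg_sub_le hA hδ0 L
    · rw [statisticalCost, if_neg hb.not_gt, if_neg hb.ne]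
      have h1 : ∑ l ∈ Finset.Icc 1 L, (A ^ (δ * (L - l))) ^ s * A ^ ((γ - b * s) * l) =
          A ^ ((γ - b * s) * L) * ∑ l ∈ Finset.Icc 1 L, A ^ (-(δ * s * (L - l))) := by
        rw [Finset.mul_sum]
        refine Finset.sum_congr rfl fun l _ => ?_
        rw [← Real.rpow_mul hA0.le, ← Real.rpow_add hA0, ← Real.rpow_add hA0, hδs]
        congr 1; ring
      have h2 : A ^ ((γ - b * s) * L) ≤ D ^ (γ - b * s) * ε ^ (-((γ - b * s) / α)) := by
        calc A ^ ((γ - b * s) * L) = (A ^ (L : ℝ)) ^ (γ - b * s) := by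
              rw [← Real.rpow_mul hA0.le, mul_comm]
          _ ≤ (D * ε ^ (-(1 / α))) ^ (γ - b * s) := by gcongr
          _ = _ := by
              rw [Real.mul_rpow hD.le (by positivity), ← Real.rpow_mul hε0.le]
              congr 2; ring
      rw [h1]
      calc ε ^ (-s) * (A ^ ((γ - b * s) * L) *
            ∑ l ∈ Finset.Icc 1 L, A ^ (-(δ * s * (L - l))))
          ≤ ε ^ (-s) * ((D ^ (γ - b * s) * ε ^ (-((γ - b * s) / α))) *
            (1 - A ^ (-(δ * s)))⁻¹) := by
            refine mul_le_mul_of_nonneg_left (mul_le_mul h2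
              (sum_Icc_rpow_neg_sub_le hA (mul_pos hδ0 hs) L)
              (Finset.sum_nonneg fun _ _ => by positivity) (by positivity)) (by positivity)
        _ = _ := by
            rw [sub_eq_add_neg (-s), Real.rpow_add hε0]; ring

/-- The choice of the finest level and of the sample numbers. -/
theorem exists_levels_samples (hA : 1 < A) {α b γ s Ca Cb Cc : ℝ} (hα : 0 < α) (hγ : 0 < γ)
    (hs : 0 < s) (hCa : 0 < Ca) (hCb : 0 < Cb) (hCc : 0 < Cc) :
    ∃ K : ℝ, 0 < K ∧ ∀ ε ∈ Set.Ioc (0 : ℝ) (1 / 2), ∃ (L : ℕ) (M : ℕ → ℕ), 1 ≤ L ∧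
      (∀ l, 1 ≤ M l) ∧ Ca * A ^ (-(α * L)) ≤ ε / 4 ∧
      ∑ l ∈ Finset.Icc 1 L, Cb * (M l : ℝ) ^ (-s⁻¹) * A ^ (-(b * l)) ≤ ε / 4 ∧
      ∑ l ∈ Finset.Icc 1 L, Cc * A ^ (γ * l) * (M l : ℝ) ≤ K * costOrder α b γ A s ε := by
  have hA0 : 0 < A := by linarith
  obtain ⟨D, hD, hlevel⟩ := exists_finest_level hA hα hCa
  obtain ⟨V, W, hV, hW, hweights⟩ := exists_weights (α := α) (b := b) (γ := γ) hA hs hD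
  have hG := one_sub_rpow_neg_inv_pos hA hγ
  set G := (1 - A ^ (-γ))⁻¹ with hGdef
  refine ⟨Cc * max (G * D ^ γ) ((4 * Cb * V) ^ s * W),
    mul_pos hCc (lt_max_of_lt_left (by positivity)), fun ε hε => ?_⟩
  obtain ⟨L, hL, hbias, hLA, hLlog⟩ := hlevel ε hε
  obtain ⟨v, hv, hvV, hvW⟩ := hweights ε hε L hL hLA hLlog
  obtain ⟨M, hM, hstat, hcost⟩ :=
    exists_samples_of_weights (b := b) (γ := γ) hA hs hCb hV hε.1 L hv hvV
  refine ⟨L, M, hL, hM, hbias, hstat, ?_⟩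
  have hε0 := hε.1
  -- The finest level dominates this geometric sum.
  have h1 : ∑ l ∈ Finset.Icc 1 L, A ^ (γ * l) ≤ G * D ^ γ * ε ^ (-(γ / α)) := by
    calc ∑ l ∈ Finset.Icc 1 L, A ^ (γ * l)
        = A ^ (γ * L) * ∑ l ∈ Finset.Icc 1 L, A ^ (-(γ * (L - l))) := by
          rw [Finset.mul_sum]
          refine Finset.sum_congr rfl fun l _ => ?_
          rw [← Real.rpow_add hA0]; congr 1; ring
      _ ≤ (D * ε ^ (-(1 / α))) ^ γ * G := by
          gcongr
          · rw [mul_comm, Real.rpow_mul hA0.le]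
            gcongr
          · exact sum_Icc_rpow_neg_sub_le hA hγ L
      _ = G * D ^ γ * ε ^ (-(γ / α)) := by
          rw [Real.mul_rpow hD.le (by positivity), ← Real.rpow_mul hε0.le,
            show -(1 / α) * γ = -(γ / α) by ring]
          ring
  have hst : 0 ≤ statisticalCost α b γ A s ε := statisticalCost_nonneg hε0.le
  simp only [mul_assoc Cc]
  rw [← Finset.mul_sum, costOrder_eq]
  gcongr
  refine hcost.trans ?_
  rw [mul_add]
  refine add_le_add ?_ ?_
  · refine h1.trans ?_
    gcongr
    exact le_max_left _ _
  · calc (4 * Cb * V) ^ s * _ ≤ (4 * Cb * V) ^ s * (W * statisticalCost α b γ A s ε) := by gcongr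
      _ = (4 * Cb * V) ^ s * W * statisticalCost α b γ A s ε := by ring
      _ ≤ _ := by gcongr; exact le_max_right _ _

end Parameters

/-! ### Bias and statistical error of the estimator. -/

section Error

variable {Ω V : Type*} [MeasurableSpace Ω] {P : Measure Ω} [IsProbabilityMeasure P]
  [NormedAddCommGroup V] [NormedSpace ℝ V]

/-- The error of the multilevel estimator is bounded by the bias plus the sum of the statistical
errors of the levels. -/
lemma eLpNorm_sub_estimator_le {q : ℝ≥0∞} (hq : 1 ≤ q) (e : V) {Xl : ℕ → Ω → V} (h0 : Xl 0 = 0)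
    (hX : ∀ l, Integrable (Xl l) P) {ξ : ℕ → ℕ → Ω → V} {L : ℕ} {M : ℕ → ℕ}
    (hξ : ∀ l ∈ Finset.Icc 1 L, ∀ j, AEStronglyMeasurable (ξ l j) P) :
    eLpNorm (fun ω => e - estimator ξ L M ω) q P ≤ ‖e - ∫ ω, Xl L ω ∂P‖ₑ +
      ∑ l ∈ Finset.Icc 1 L, eLpNorm (fun ω => (1 / (M l : ℝ)) • (∑ j ∈ Finset.range (M l), ξ l j ω) -
        ∫ ω', (Xl l ω' - Xl (l - 1) ω') ∂P) q P := by
  -- The means telescope because level 0 is zero.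
  have htel : ∑ l ∈ Finset.Icc 1 L, ∫ ω', (Xl l ω' - Xl (l - 1) ω') ∂P = ∫ ω, Xl L ω ∂P := by
    have : ∀ n : ℕ, ∑ l ∈ Finset.Icc 1 n, ∫ ω', (Xl l ω' - Xl (l - 1) ω') ∂P =
        ∫ ω, Xl n ω ∂P := by
      intro n
      induction n with
      | zero => simp [h0]
      | succ n ih =>
        rw [Finset.sum_Icc_succ_top (by omega), ih, Nat.add_sub_cancel,
          integral_sub (hX _) (hX _), add_sub_cancel]
    exact this L
  have heq : (fun ω => e - estimator ξ L M ω) = (fun _ => e - ∫ ω, Xl L ω ∂P) -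
      ∑ l ∈ Finset.Icc 1 L, fun ω => (1 / (M l : ℝ)) • (∑ j ∈ Finset.range (M l), ξ l j ω) -
        ∫ ω', (Xl l ω' - Xl (l - 1) ω') ∂P := by
    ext1 ω
    simp only [estimator, Pi.sub_apply, Finset.sum_apply, Finset.sum_sub_distrib, htel]
    abel
  have hmeas : ∀ l ∈ Finset.Icc 1 L, AEStronglyMeasurable (fun ω => (1 / (M l : ℝ)) •
      (∑ j ∈ Finset.range (M l), ξ l j ω) - ∫ ω', (Xl l ω' - Xl (l - 1) ω') ∂P) P := fun l hl =>
    ((Finset.aestronglyMeasurable_fun_sum _ fun j _ => hξ l hl j).const_smul _).sub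
      aestronglyMeasurable_const
  rw [heq]
  refine (eLpNorm_sub_le aestronglyMeasurable_const
    (Finset.aestronglyMeasurable_sum _ hmeas) hq).trans (add_le_add ?_ (eLpNorm_sum_le hmeas hq))
  rw [eLpNorm_const _ (zero_lt_one.trans_le hq).ne' (IsProbabilityMeasure.ne_zero P)]
  simp

end Error

/-! ### From `N l` to powers of `A`, and the theorem. -/

lemma mul_rpow_neg_le_of_le {A c N a : ℝ} (hA : 0 < A) (hc : 0 < c) (ha : 0 < a) {l : ℕ}
    (h : c * A ^ l ≤ N) : N ^ (-a) ≤ c ^ (-a) * A ^ (-(a * l)) := by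
  refine (Real.rpow_le_rpow_of_nonpos (by positivity) h (by linarith)).trans_eq ?_
  rw [Real.mul_rpow hc.le (by positivity), ← Real.rpow_natCast A l, ← Real.rpow_mul hA.le]
  congr 2; ring

lemma rpow_le_of_le_mul {A c N a : ℝ} (hA : 0 < A) (hc : 0 < c) (hN : 0 ≤ N) (ha : 0 < a) {l : ℕ}
    (h : N ≤ c * A ^ l) : N ^ a ≤ c ^ a * A ^ (a * l) := by
  refine (Real.rpow_le_rpow hN h ha.le).trans_eq ?_
  rw [Real.mul_rpow hc.le (by positivity), ← Real.rpow_natCast A l, ← Real.rpow_mul hA.le]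
  congr 2; ring

end MLMC

theorem mainTheorem5
    (p : ℝ≥0∞) [Fact (1 ≤ p)] (q qt : ℝ) (hq1 : 1 < q) (hq2 : q < 2)
    (hpq : p ≤ ENNReal.ofReal q) (hqt : q ≤ qt)
    (β : ℝ → ℝ) (hβ : ∀ r ∈ Set.Icc q (min qt 2), 0 < β r)
    (α γ Cα Cβ Cγ A c₁ c₂ : ℝ) (hα : 0 < α) (hγ : 0 < γ)
    (hCα : 0 < Cα) (hCβ : 0 < Cβ) (hCγ : 0 < Cγ) (hA : 1 < A) (hc₁ : 0 < c₁) (hc₂ : 0 < c₂)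
    (r : ℝ) (hr : r ∈ Set.Icc q (min qt 2)) :
    -- the constant depends only on the parameters above
    ∃ K : ℝ, 0 < K ∧
      ∀ (S : Type u) [MeasurableSpace S] (μ : Measure S) [SigmaFinite μ]
        (_ : MLMC.ApproxByAveraging.{u, v} μ)
        (Ω : Type v) [MeasurableSpace Ω] (P : Measure Ω) [IsProbabilityMeasure P]
        [MeasurableSpace (Lp ℝ p μ)] [BorelSpace (Lp ℝ p μ)]
        (X : Ω → Lp ℝ p μ) (_ : MemLp X 1 P)
        -- the approximations `X_ℓ`, `ℓ ≥ 1`, with the convention `X_0 = 0`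
        (Xl : ℕ → Ω → Lp ℝ p μ) (_ : Xl 0 = 0)
        (_ : ∀ l, 1 ≤ l → MemLp (Xl l) (ENNReal.ofReal qt) P ∧
          MLMC.MemSwap P (ENNReal.ofReal qt) (Xl l))
        (N cost : ℕ → ℝ)
        (_ : ∀ l, 1 ≤ l → c₁ * A ^ l ≤ N l ∧ N l ≤ c₂ * A ^ l)
        (_ : ∀ l, 1 ≤ l → ‖(∫ ω, X ω ∂P) - ∫ ω, Xl l ω ∂P‖ ≤ Cα * N l ^ (-α))
        (_ : ∀ ρ ∈ Set.Icc q (min qt 2), ∀ l, 1 ≤ l →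
          MLMC.swapNorm P (ENNReal.ofReal ρ)
            (fun ω => Xl l ω - (∫ ω', Xl l ω' ∂P) - (Xl (l - 1) ω - ∫ ω', Xl (l - 1) ω' ∂P))
            ≤ ENNReal.ofReal (Cβ * N l ^ (-β ρ)))
        (_ : ∀ l, 1 ≤ l → cost l ≤ Cγ * N l ^ γ)
        -- independent copies `ξ_{ℓ,j}` of `ξ_ℓ = X_ℓ - X_{ℓ-1}`
        (ξ : ℕ → ℕ → Ω → Lp ℝ p μ)
        (_ : ∀ l, 1 ≤ l → ∀ j, MemLp (ξ l j) (ENNReal.ofReal qt) P ∧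
          MLMC.MemSwap P (ENNReal.ofReal qt) (ξ l j))
        (_ : ∀ l, 1 ≤ l → iIndepFun (ξ l) P)
        (_ : ∀ l, 1 ≤ l → ∀ j, IdentDistrib (ξ l j) (fun ω => Xl l ω - Xl (l - 1) ω) P P)
        (ε : ℝ) (_ : ε ∈ Set.Ioc (0 : ℝ) (1 / 2)),
        ∃ (L : ℕ) (M : ℕ → ℕ), 1 ≤ L ∧ (∀ l ∈ Finset.Icc 1 L, 1 ≤ M l) ∧
          eLpNorm (fun ω => (∫ ω', X ω' ∂P) - MLMC.estimator ξ L M ω) (ENNReal.ofReal q) P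
            < ENNReal.ofReal ε ∧
          MLMC.totalCost cost L M ≤ K * MLMC.costOrder α (β r) γ A (Real.conjExponent r) ε := by
  have hA0 : 0 < A := by linarith
  have hqr : q ≤ r := hr.1
  have hr1 : 1 < r := hq1.trans_le hqr
  have hr2 : r ≤ 2 := hr.2.trans (min_le_right _ _)
  have hrqt : r ≤ qt := hr.2.trans (min_le_left _ _)
  have hconj : r.HolderConjugate r.conjExponent := Real.HolderConjugate.conjExponent hr1
  have hs : 0 < r.conjExponent := hconj.symm.pos
  have hsinv : 1 - r⁻¹ = r.conjExponent⁻¹ := hconj.one_sub_inv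
  have hb := hβ r hr
  -- `c₁` and `c₂` are absorbed into the constants, and the 4 in `Cb` is that of the sample mean
  -- bound. `K` is fixed before the spaces are introduced.
  obtain ⟨K, hK, hparam⟩ := MLMC.exists_levels_samples (b := β r) (s := r.conjExponent) hA hα hγ hs
    (Ca := Cα * c₁ ^ (-α)) (Cb := 4 * (Cβ * c₁ ^ (-β r))) (Cc := Cγ * c₂ ^ γ)
    (by positivity) (by positivity) (by positivity)
  refine ⟨K, hK, ?_⟩
  intro S _ μ _ hav Ω _ P _ _ _ X _ Xl hX0 hXl N cost hN hbias hstrong hcost ξ hξ hind hid ε hε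
  obtain ⟨L, M, hL, hM, hbiasL, hstatL, hcostL⟩ := hparam ε hε
  have hone : ∀ x : ℝ, 1 < x → (1 : ℝ≥0∞) ≤ ENNReal.ofReal x := fun x hx => by
    rw [← ENNReal.ofReal_one]; exact ENNReal.ofReal_le_ofReal hx.le
  have hXint : ∀ l, Integrable (Xl l) P := by
    intro l
    rcases Nat.eq_zero_or_pos l with rfl | hl
    · rw [hX0]; exact integrable_zero _ _ _
    · exact (hXl l hl).1.integrable (hone qt (hr1.trans_le hrqt))
  have hNpos : ∀ l, 1 ≤ l → 0 < N l := fun l hl =>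
    lt_of_lt_of_le (by positivity) (hN l hl).1
  refine ⟨L, M, hL, fun l _ => hM l, ?_, ?_⟩
  · have hlevel : ∀ l ∈ Finset.Icc 1 L, eLpNorm (fun ω => (1 / (M l : ℝ)) •
        (∑ j ∈ Finset.range (M l), ξ l j ω) - ∫ ω', (Xl l ω' - Xl (l - 1) ω') ∂P)
        (ENNReal.ofReal q) P ≤ ENNReal.ofReal (4 * (Cβ * c₁ ^ (-β r)) *
          (M l : ℝ) ^ (-r.conjExponent⁻¹) * A ^ (-(β r * l))) := by
      intro l hl
      have hl1 := (Finset.mem_Icc.1 hl).1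
      have : Fact (1 ≤ ENNReal.ofReal r) := ⟨hone r hr1⟩
      have hswap : ∀ j, MLMC.MemSwap P (ENNReal.ofReal r) (ξ l j) := fun j =>
        ⟨this, (hξ l hl1 j).2.exists_isSwap_of_le (ENNReal.ofReal_le_ofReal hrqt)⟩
      have hmean := MLMC.eLpNorm_sampleMean_sub_le hav hq1 hpq hqr hr2
        ((hXint l).sub (hXint (l - 1))) hswap (hind l hl1) (hid l hl1) (hM l)
      have hnorm := hstrong r hr l hl1
      have hfun : (fun ω => Xl l ω - (∫ ω', Xl l ω' ∂P) -
          (Xl (l - 1) ω - ∫ ω', Xl (l - 1) ω' ∂P)) = fun ω => (Xl l - Xl (l - 1)) ω -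
            ∫ ω', (Xl l - Xl (l - 1)) ω' ∂P := by
        ext1 ω
        simp only [Pi.sub_apply]
        rw [integral_sub (hXint _) (hXint _)]
        abel
      rw [hfun] at hnorm
      refine hmean.trans ((mul_le_mul_right hnorm _).trans ?_)
      rw [← ENNReal.ofReal_mul (by positivity), hsinv]
      refine ENNReal.ofReal_le_ofReal ?_
      have := MLMC.mul_rpow_neg_le_of_le hA0 hc₁ hb (hN l hl1).1
      calc 4 * (M l : ℝ) ^ (-r.conjExponent⁻¹) * (Cβ * N l ^ (-β r))
          ≤ 4 * (M l : ℝ) ^ (-r.conjExponent⁻¹) * (Cβ * (c₁ ^ (-β r) * A ^ (-(β r * l)))) := by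
            gcongr
        _ = _ := by ring
    have hb1 : ‖(∫ ω, X ω ∂P) - ∫ ω, Xl L ω ∂P‖ₑ ≤ ENNReal.ofReal (ε / 4) := by
      rw [← ofReal_norm]
      refine ENNReal.ofReal_le_ofReal ((hbias L hL).trans (le_trans ?_ hbiasL))
      rw [mul_assoc]
      gcongr
      exact MLMC.mul_rpow_neg_le_of_le hA0 hc₁ hα (hN L hL).1
    have hb2 := (Finset.sum_le_sum hlevel).trans_eq
      (ENNReal.ofReal_sum_of_nonneg fun l _ => by positivity).symm
    refine (MLMC.eLpNorm_sub_estimator_le (hone q hq1) _ hX0 hXint fun l hl j =>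
      (hξ l (Finset.mem_Icc.1 hl).1 j).1.1).trans_lt ?_
    -- Bias and statistical error total at most `ε / 2`, whence the strict inequality.
    refine (add_le_add hb1 (hb2.trans (ENNReal.ofReal_le_ofReal hstatL))).trans_lt ?_
    have hε0 := hε.1
    rw [← ENNReal.ofReal_add (by positivity) (by positivity)]
    exact (ENNReal.ofReal_lt_ofReal_iff hε0).2 (by linarith)
  · refine le_trans (Finset.sum_le_sum fun l hl => ?_) hcostL
    have hl1 := (Finset.mem_Icc.1 hl).1
    refine mul_le_mul_of_nonneg_right ((hcost l hl1).trans ?_) (Nat.cast_nonneg _)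
    rw [mul_assoc]
    gcongr
    exact MLMC.rpow_le_of_le_mul hA0 hc₂ (hNpos l hl1).le hγ (hN l hl1).2
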